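/- Let $d\ge 1$ and $N\ge 2$ be integers, and let $\mathbb T^d=(\mathbb R/2\pi\mathbb Z)^d$ and its powers carry normalised Haar measure. For $i=1,\dots,N$ let $\hat\varepsilon_i:\mathbb Z^d\to\mathbb C$ satisfy $\hat\varepsilon_i(y)=\overline{\hat\varepsilon_i(-y)}$ for all $y\in\mathbb Z^d$ and $\sum_{y}|y|_+^{\delta}\,|\hat\varepsilon_i(y)|<\infty$ for some $\delta>0$, where $|y|_+=|y^{(1)}|+\dots+|y^{(d)}|$, and put $\varepsilon_i(p)=\sum_{s\in\mathbb Z^d}\hat\varepsilon_i(s)e^{\mathrm i(s,p)}$, $p\in\mathbb T^d$. For $1\le i<j\le N$ let $\hat v_{ij}:\mathbb Z^d\to\mathbb R$ tend to $0$ at infinity. For a nonempty set of particles $A=\{\alpha_1<\dots<\alpha_m\}\subset\{1,\dots,N\}$ and $k\in\mathbb T^d$ let $\mathbb F^A_k=\{p=(p_\alpha)_{\alpha\in A}\in(\mathbb T^d)^A:\ \sum_{\alpha\in A}p_\alpha=k\}$. Omitting the coordinate $p_{\alpha_m}$ identifies $\mathbb F^A_k$ with $(\mathbb T^d)^{m-1}$;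 $\mathbb F_k^A$ carries the measure transported by this identification, and $U_k:L_2(\mathbb F^A_k)\to L_2((\mathbb T^d)^{m-1})$ is the corresponding unitary operator. In $L_2(\mathbb F^A_k)$ let $$\tilde h^{A}(k)=\tilde h^{A}_0(k)-\sum_{i,j\in A,\ i<j}\tilde v_{ij},\qquad (\tilde h^A_0(k)f)(p)=\Big(\sum_{\alpha\in A}\varepsilon_\alpha(p_\alpha)\Big)f(p),$$ where $\tilde v_{ij}$ is the bounded operator that multiplies each character $e^{\mathrm i\sum_{\alpha\in A}(x_\alpha,p_\alpha)}$, $x\in(\mathbb Z^d)^A$, by $\hat v_{ij}(x_i-x_j)$. (If $\hat v_{ij}\in\ell_2(\mathbb Z^d)$, then $\tilde v_{ij}$ is the partial integral operator $f\mapsto\int_{\mathbb T^d} \big(\sum_s\hat v_{ij}(s)e^{\mathrm i(s,p_i-q_i)}\big)f(\dots,q_i,\dots,p_i+p_j-q_i,\dots)\,dq_i$.) For $K\in\mathbb T^d$ and $A=\{1,\dots,N\}$ let $H(K)=U_K\,\tilde h^{\{1,\dots,N\}}(K)\,U_K^{-1}$ and $V_{ij}=U_K\tilde v_{ij}U_K^{-1}$,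 operators in $L_2((\mathbb T^d)^{N-1})$ ($V_{ij}$ does not depend on $K$). Let $C=\{C_1,\dots,C_l\}$ be a cluster decomposition, that is, a partition of $\{1,\dots,N\}$ into nonempty sets (clusters), with $l\ge 2$. The cluster operator is $H^C(K)=H(K)+I^C$, where $I^C$ is the sum of all $V_{ij}$, $i<j$, with $i$ and $j$ in different clusters. Then, for every $K\in\mathbb T^d$, $$\sigma(H^C(K))=\sigma_{\mathrm{ess}}(H^C(K))=\bigcup_{\substack{k_1,\dots,k_l\in\mathbb T^d\\ k_1+\dots+k_l=K}}\big\{\sigma(\tilde h^{C_1}(k_1))+\dots+\sigma(\tilde h^{C_l}(k_l))\big\},$$ where $A+B=\{x+y:\ x\in A,\ y\in B\}$, and the essential spectrum of a bounded self-adjoint operator is its spectrum without the isolated points that are eigenvalues of finite multiplicity. -/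

import Mathlib

open Filter Topology MeasureTheory
open scoped ENNReal Pointwise ComplexConjugate

noncomputable section

namespace LatticeSchrodinger

/-! ### Tori, Hilbert spaces and the Fourier transform

The torus `ℝ / 2πℤ` is parametrised by `ℝ / ℤ` through `p = 2πθ`, so that the character
`exp(i (s, p))` of the `d`-dimensional torus is `UnitAddTorus.mFourier s`. The space `(𝕋^d)^σ`,
for a finite set `σ` of particles, is `UnitAddTorus (σ × Fin d)`. -/

/-- Normalised Haar measure on the torus with coordinates indexed by `σ`. -/
def torusMeasure (σ : Type) [Fintype σ] : Measure (UnitAddTorus σ) :=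
  Measure.pi fun _ : σ => (AddCircle.haarAddCircle : Measure UnitAddCircle)

instance torusMeasure_isProbabilityMeasure (σ : Type) [Fintype σ] :
    IsProbabilityMeasure (torusMeasure σ) := by
  unfold torusMeasure
  infer_instance

/-- The Hilbert space `L₂` of the torus. -/
abbrev TorusL2 (σ : Type) [Fintype σ] : Type := Lp ℂ 2 (torusMeasure σ)

/-- The Hilbert space `ℓ₂` of the lattice. -/
abbrev LatticeL2 (σ : Type) : Type := lp (fun _ : σ → ℤ => ℂ) 2

/-- The orthonormal basis of `L₂` of the torus that consists of the characters. -/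
def characterBasis (σ : Type) [Fintype σ] : HilbertBasis (σ → ℤ) ℂ (TorusL2 σ) :=
  UnitAddTorus.mFourierBasis (d := σ)

theorem characterBasis_apply (σ : Type) [Fintype σ] (n : σ → ℤ) :
    characterBasis σ n =
      ContinuousMap.toLp 2 (torusMeasure σ) ℂ (UnitAddTorus.mFourier n) :=
  congrFun (UnitAddTorus.coe_mFourierBasis (d := σ)) n

/-- The Fourier transform, a unitary operator from `ℓ₂` of the lattice onto `L₂` of the torus; it
sends the sequence `f` to the Fourier series with coefficients `f`. -/
def fourierTransform (σ : Type) [Fintype σ] : LatticeL2 σ ≃ₗᵢ[ℂ] TorusL2 σ :=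
  (characterBasis σ).repr.symm

theorem memℓp_two_mul {X : Type} {w : X → ℂ} {M : ℝ} (hM : ∀ x, ‖w x‖ ≤ M)
    {f : X → ℂ} (hf : Memℓp f 2) : Memℓp (fun x => w x * f x) 2 := by
  refine (hf.const_mul (M : ℂ)).mono' fun x => ?_
  rw [norm_mul, norm_mul]
  refine mul_le_mul_of_nonneg_right ((hM x).trans ?_) (norm_nonneg _)
  simpa using le_abs_self M

open scoped Classical in
/-- Multiplication by a bounded function `w` in `ℓ₂`. (For an unbounded `w`, which does not occur
below, the value is `0`.) -/
def latticeMul {σ : Type} (w : (σ → ℤ) → ℂ) : LatticeL2 σ →L[ℂ] LatticeL2 σ :=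
  if h : ∃ M : ℝ, ∀ x, ‖w x‖ ≤ M then
    LinearMap.mkContinuousOfExistsBound
      { toFun := fun f => ⟨fun x => w x * f x, memℓp_two_mul h.choose_spec (lp.memℓp f)⟩
        map_add' := fun f g => lp.ext (funext fun x => mul_add (w x) (f x) (g x))
        map_smul' := fun c f => lp.ext (funext fun x => mul_left_comm (w x) c (f x)) }
      ⟨h.choose, fun f => by
        have hM : 0 ≤ h.choose := (norm_nonneg _).trans (h.choose_spec 0)
        have h2 : (0 : ℝ) < (2 : ℝ≥0∞).toReal := by norm_num
        refine lp.norm_le_of_forall_sum_le h2 (by positivity) fun s => ?_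
        have h3 : ∀ x, ‖w x * f x‖ ^ (2 : ℝ≥0∞).toReal
            ≤ h.choose ^ (2 : ℝ≥0∞).toReal * ‖f x‖ ^ (2 : ℝ≥0∞).toReal := fun x => by
          rw [← Real.mul_rpow hM (norm_nonneg _), norm_mul]
          exact Real.rpow_le_rpow (by positivity)
            (mul_le_mul_of_nonneg_right (h.choose_spec x) (norm_nonneg _)) h2.le
        refine (Finset.sum_le_sum fun x _ => h3 x).trans ?_
        rw [← Finset.mul_sum, Real.mul_rpow hM (norm_nonneg _)]
        exact mul_le_mul_of_nonneg_left (lp.sum_rpow_le_norm_rpow h2 f s) (by positivity)⟩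
  else 0

/-- Multiplication by a continuous function in `L₂(X, μ)`, for `X` compact. -/
def continuousMul {X : Type} [TopologicalSpace X] [CompactSpace X] [MeasurableSpace X]
    [BorelSpace X] (μ : Measure X) [IsFiniteMeasure μ] (g : C(X, ℂ)) :
    Lp ℂ 2 μ →L[ℂ] Lp ℂ 2 μ :=
  (ContinuousLinearMap.mul ℂ ℂ).holderL μ ∞ 2 2 (ContinuousMap.toLp ∞ μ ℂ g)

/-! ### The manifold of fixed total quasi-momentum

The particles are labelled by a nonempty finite linearly ordered set `ι`. -/

/-- The last particle. -/
def lastParticle (ι : Type) [Fintype ι] [LinearOrder ι] [Nonempty ι] : ι :=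
  Finset.univ.max' Finset.univ_nonempty

/-- All particles except the last one. -/
abbrev Others (ι : Type) [Fintype ι] [LinearOrder ι] [Nonempty ι] : Type :=
  {i : ι // i ≠ lastParticle ι}

/-- The configurations of quasi-momenta with sum `k`. -/
abbrev Fiber (ι : Type) [Fintype ι] {d : ℕ} (k : UnitAddTorus (Fin d)) : Type :=
  {p : ι → UnitAddTorus (Fin d) // ∑ i, p i = k}

instance fiber_compactSpace (ι : Type) [Fintype ι] {d : ℕ} (k : UnitAddTorus (Fin d)) :
    CompactSpace (Fiber ι k) := by
  refine isCompact_iff_compactSpace.mp (IsClosed.isCompact ?_)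
  exact isClosed_eq (by fun_prop) continuous_const

instance fiber_borelSpace (ι : Type) [Fintype ι] {d : ℕ} (k : UnitAddTorus (Fin d)) :
    BorelSpace (Fiber ι k) :=
  haveI : BorelSpace (ι → UnitAddTorus (Fin d)) := Pi.borelSpace
  Subtype.borelSpace _

section Particles

variable {ι : Type} [Fintype ι] [LinearOrder ι] [Nonempty ι] {d : ℕ}

theorem sum_eq_last_add (p : ι → UnitAddTorus (Fin d)) :
    ∑ i, p i = p (lastParticle ι) + ∑ i : Others ι, p i := by
  classical
  rw [Fintype.sum_eq_add_sum_compl (lastParticle ι)]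
  congr 1
  exact (Finset.sum_subtype _ (by simp) p)

/-- The inverse of the map that omits the quasi-momentum of the last particle: the missing
quasi-momentum is `k - ∑ pᵢ`. -/
def insertLast (k : UnitAddTorus (Fin d)) (q : UnitAddTorus (Others ι × Fin d)) :
    ι → UnitAddTorus (Fin d) :=
  fun i => if h : i ≠ lastParticle ι then fun a => q (⟨i, h⟩, a)
    else k - ∑ m : Others ι, fun a => q (m, a)

theorem continuous_insertLast (k : UnitAddTorus (Fin d)) :
    Continuous (insertLast (ι := ι) k) := by
  refine continuous_pi fun i => ?_
  unfold insertLast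
  by_cases h : i ≠ lastParticle ι
  · simp only [dif_pos h]
    fun_prop
  · simp only [dif_neg h]
    fun_prop

theorem sum_insertLast (k : UnitAddTorus (Fin d)) (q : UnitAddTorus (Others ι × Fin d)) :
    ∑ i, insertLast k q i = k := by
  rw [sum_eq_last_add]
  have h : ∀ m : Others ι, insertLast k q m = fun a => q (m, a) := fun m => by
    simp [insertLast, m.2]
  simp only [h]
  simp [insertLast]

theorem insertLast_omit (k : UnitAddTorus (Fin d)) (p : ι → UnitAddTorus (Fin d))
    (hp : ∑ i, p i = k) : insertLast k (fun m : Others ι × Fin d => p m.1 m.2) = p := by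
  funext i
  by_cases h : i ≠ lastParticle ι
  · simp [insertLast, h]
  · rw [sum_eq_last_add] at hp
    simp only [insertLast, dif_neg h]
    rw [not_not] at h
    subst h
    rw [sub_eq_iff_eq_add]
    exact hp.symm

/-- Omitting the quasi-momentum of the last particle identifies the manifold of total
quasi-momentum `k` with the torus of all other quasi-momenta. -/
def omitLast (k : UnitAddTorus (Fin d)) :
    Fiber ι k ≃ₜ UnitAddTorus (Others ι × Fin d) where
  toFun p := fun m => p.1 m.1 m.2
  invFun q := ⟨insertLast k q, sum_insertLast k q⟩
  left_inv p := Subtype.ext (insertLast_omit k p.1 p.2)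
  right_inv q := funext fun m => by simp [insertLast, m.1.2]
  continuous_toFun := continuous_pi fun m =>
    (continuous_apply m.2).comp ((continuous_apply m.1.1).comp continuous_subtype_val)
  continuous_invFun := (continuous_insertLast k).subtype_mk _

variable (ι) in
/-- The translation invariant probability measure on the manifold of total quasi-momentum `k`. -/
def fiberMeasure (k : UnitAddTorus (Fin d)) : Measure (Fiber ι k) :=
  (torusMeasure (Others ι × Fin d)).map (omitLast k).symm

instance fiberMeasure_isProbabilityMeasure (k : UnitAddTorus (Fin d)) :
    IsProbabilityMeasure (fiberMeasure ι k) :=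
  Measure.isProbabilityMeasure_map (omitLast k).symm.continuous.measurable.aemeasurable

theorem measurePreserving_omitLast_symm (k : UnitAddTorus (Fin d)) :
    MeasurePreserving (omitLast (ι := ι) k).symm (torusMeasure (Others ι × Fin d))
      (fiberMeasure ι k) :=
  ⟨(omitLast k).symm.continuous.measurable, rfl⟩

theorem measurePreserving_omitLast (k : UnitAddTorus (Fin d)) :
    MeasurePreserving (omitLast (ι := ι) k) (fiberMeasure ι k)
      (torusMeasure (Others ι × Fin d)) :=
  (measurePreserving_omitLast_symm k).symm (omitLast k).symm.toMeasurableEquiv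

variable (ι) in
/-- `L₂` of the manifold of total quasi-momentum `k`. -/
abbrev FiberL2 (k : UnitAddTorus (Fin d)) : Type := Lp ℂ 2 (fiberMeasure ι k)

/-- The unitary operator `g ↦ g ∘ (omitLast k)⁻¹`. -/
def fiberUnitary (k : UnitAddTorus (Fin d)) :
    FiberL2 ι k ≃ₗᵢ[ℂ] TorusL2 (Others ι × Fin d) where
  toFun := Lp.compMeasurePreserving _ (measurePreserving_omitLast_symm k)
  map_add' := map_add _
  map_smul' := (Lp.compMeasurePreservingₗ ℂ _ (measurePreserving_omitLast_symm k)).map_smul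
  invFun := Lp.compMeasurePreserving _ (measurePreserving_omitLast k)
  left_inv f := by
    change Lp.compMeasurePreserving _ _ (Lp.compMeasurePreserving _ _ f) = f
    rw [← Lp.compMeasurePreserving_comp_apply]
    simp
  right_inv f := by
    change Lp.compMeasurePreserving _ _ (Lp.compMeasurePreserving _ _ f) = f
    rw [← Lp.compMeasurePreserving_comp_apply]
    simp
  norm_map' f := Lp.norm_compMeasurePreserving f _

/-! ### Schrödinger operators of a system of particles

`e i` is the dispersion function of the particle `i`, and `v i j`, for `i < j`, is the potential of
the pair `i, j`. -/

/-- The symbol `ε(p) = ∑ₛ e(s) exp(i (s, p))`; the series converges uniformly if `e` is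
absolutely summable. -/
def symbol (e : (Fin d → ℤ) → ℂ) : C(UnitAddTorus (Fin d), ℂ) :=
  ∑' s : Fin d → ℤ, e s • UnitAddTorus.mFourier s

/-- The function `p ↦ ∑ εᵢ(pᵢ)` on the manifold of total quasi-momentum `k`. -/
def kineticSymbol (e : ι → (Fin d → ℤ) → ℂ) (k : UnitAddTorus (Fin d)) : C(Fiber ι k, ℂ) :=
  ∑ i, (symbol (e i)).comp ⟨fun p : Fiber ι k => p.1 i, (continuous_apply i).comp continuous_subtype_val⟩

/-- The position of the particle `i`, relative to the last particle. -/
def position (x : Others ι × Fin d → ℤ) (i : ι) : Fin d → ℤ :=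
  fun a => if h : i ≠ lastParticle ι then x (⟨i, h⟩, a) else 0

/-- The potential of the pair `i, j` in the momentum representation: the conjugate, by the Fourier
transform, of multiplication by `w (xᵢ - xⱼ)`, where the last particle is at the origin. -/
def potential (w : (Fin d → ℤ) → ℝ) (i j : ι) :
    TorusL2 (Others ι × Fin d) →L[ℂ] TorusL2 (Others ι × Fin d) :=
  (fourierTransform (Others ι × Fin d)).toContinuousLinearEquiv ∘L
    latticeMul (fun x => (w (position x i - position x j) : ℂ)) ∘L
    (fourierTransform (Others ι × Fin d)).symm.toContinuousLinearEquiv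

/-- The potential of the pair `i, j` as an operator in `L₂` of the manifold of total quasi-momentum
`k`. It sends the character `exp(i ∑ (xₘ, pₘ))` to its multiple by `w (xᵢ - xⱼ)`; for square
summable `w` it is the partial integral operator whose kernel is the Fourier series of `w`. -/
def fiberPotential (w : (Fin d → ℤ) → ℝ) (i j : ι) (k : UnitAddTorus (Fin d)) :
    FiberL2 ι k →L[ℂ] FiberL2 ι k :=
  (fiberUnitary (ι := ι) k).symm.toContinuousLinearEquiv ∘L potential w i j ∘L
    (fiberUnitary (ι := ι) k).toContinuousLinearEquiv

/-- The Schrödinger operator of the system of particles `ι` with total quasi-momentum `k`, in `L₂`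
of the manifold of total quasi-momentum `k`. -/
def fiberHamiltonian (e : ι → (Fin d → ℤ) → ℂ) (v : ι → ι → (Fin d → ℤ) → ℝ)
    (k : UnitAddTorus (Fin d)) : FiberL2 ι k →L[ℂ] FiberL2 ι k :=
  continuousMul (fiberMeasure ι k) (kineticSymbol e k)
    - ∑ ij : ι × ι with ij.1 < ij.2, fiberPotential (v ij.1 ij.2) ij.1 ij.2 k

/-- The Schrödinger operator of the system of particles `ι` with total quasi-momentum `k`, in `L₂`
of the torus of the quasi-momenta of all particles but the last. -/
def hamiltonian (e : ι → (Fin d → ℤ) → ℂ) (v : ι → ι → (Fin d → ℤ) → ℝ)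
    (k : UnitAddTorus (Fin d)) :
    TorusL2 (Others ι × Fin d) →L[ℂ] TorusL2 (Others ι × Fin d) :=
  (fiberUnitary (ι := ι) k).toContinuousLinearEquiv ∘L fiberHamiltonian e v k ∘L
    (fiberUnitary (ι := ι) k).symm.toContinuousLinearEquiv

end Particles

/-! ### Cluster decompositions -/

section Clusters

variable {N d : ℕ} [NeZero N]

instance cluster_nonempty (C : Finpartition (Finset.univ : Finset (Fin N)))
    (c : {s : Finset (Fin N) // s ∈ C.parts}) : Nonempty {i : Fin N // i ∈ c.1} :=
  (C.nonempty_of_mem_parts c.2).to_subtype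

/-- The sum of all pair potentials that link different clusters. -/
def interCluster (v : Fin N → Fin N → (Fin d → ℤ) → ℝ)
    (C : Finpartition (Finset.univ : Finset (Fin N))) :
    TorusL2 (Others (Fin N) × Fin d) →L[ℂ] TorusL2 (Others (Fin N) × Fin d) :=
  ∑ ij : Fin N × Fin N with ij.1 < ij.2 ∧ ¬ ∃ s ∈ C.parts, ij.1 ∈ s ∧ ij.2 ∈ s,
    potential (v ij.1 ij.2) ij.1 ij.2

/-- The cluster operator. -/
def clusterOperator (e : Fin N → (Fin d → ℤ) → ℂ) (v : Fin N → Fin N → (Fin d → ℤ) → ℝ)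
    (C : Finpartition (Finset.univ : Finset (Fin N))) (K : UnitAddTorus (Fin d)) :
    TorusL2 (Others (Fin N) × Fin d) →L[ℂ] TorusL2 (Others (Fin N) × Fin d) :=
  hamiltonian e v K + interCluster v C

/-- The Schrödinger operator of the subsystem of the particles in the cluster `c`, with total
quasi-momentum `k`. -/
def clusterHamiltonian (e : Fin N → (Fin d → ℤ) → ℂ) (v : Fin N → Fin N → (Fin d → ℤ) → ℝ)
    (C : Finpartition (Finset.univ : Finset (Fin N))) (c : {s : Finset (Fin N) // s ∈ C.parts})
    (k : UnitAddTorus (Fin d)) :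
    FiberL2 {i : Fin N // i ∈ c.1} k →L[ℂ] FiberL2 {i : Fin N // i ∈ c.1} k :=
  fiberHamiltonian (ι := {i : Fin N // i ∈ c.1}) (fun i => e i) (fun i j => v i j) k

end Clusters

/-! ### Essential spectrum -/

/-- The essential spectrum of a bounded self-adjoint operator: the spectrum without the isolated
points that are eigenvalues of finite multiplicity. -/
def essentialSpectrum {E : Type} [NormedAddCommGroup E] [InnerProductSpace ℂ E]
    (A : E →L[ℂ] E) : Set ℂ :=
  {z ∈ spectrum ℂ A | ¬ ((∃ r > 0, ∀ u ∈ spectrum ℂ A, dist u z < r → u = z) ∧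
    Module.End.HasEigenvalue (A : E →ₗ[ℂ] E) z ∧
    FiniteDimensional ℂ (Module.End.eigenspace (A : E →ₗ[ℂ] E) z))}

end LatticeSchrodinger

end

/-! The Fourier transform, with the last particle as origin, turns the cluster operator into an
operator in ℓ₂ of relative positions: kinetic terms become absolutely convergent series of
translations, pair potentials become multiplications. Since all inter-cluster potentials cancel, it
is a sum of self-adjoint operators H_c (`clusterPart`), one per cluster. They commute with one
another and with the unitary translations U_c(s) of whole clusters (`clusterShift`). A direct
integral over the cluster quasi-momenta is replaced throughout by joint approximate eigenvectors.

Freezing: on unit vectors with U_c(s) f ≈ e^{i(s,k_c)} f for all s, H_c differs little from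
`frozenPart`, in which the cluster has the fixed quasi-momentum k_c
(`tendsto_clusterPart_sub_frozenPart`). The frozen operator is a direct sum of copies of the cluster
Hamiltonian, one on each slice with prescribed cluster positions (`slice_frozenPart`).

From left to right: a spectral value z of ∑ H_c is the value of a character of the commutative
C*-algebra generated by all H_c and U_c(s), and characters yield joint approximate eigenvectors
(`exists_joint_approxEigen`). The limits of U_c(s) form a unitary character of ℤ^d and thus define
k_c. The product of the U_c(s) over c is the scalar e^{i(s,K)}, whence ∑ k_c = K. The limits w_c of
H_c add up to z, and a uniform resolvent bound on the slices would exclude w_c from being an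
approximate eigenvalue of the frozen operator if it lay outside the spectrum of the cluster
Hamiltonian.

From right to left: `trial` multiplies approximate eigenvectors of the clusters by a plane wave in
the cluster positions and a slowly decaying exponential; as the decay rate tends to zero, these
become joint approximate eigenvectors.

The spectrum is essential because a cluster without the last particle has a nontrivial translation
that commutes with the operator and has no eigenvector in ℓ₂. No eigenspace can then be nonzero and
finite dimensional. -/

noncomputable section

namespace LatticeSchrodinger

/-! ### Operators in `ℓ₂` -/

section Pullback

variable {α β γ : Type}

/-- The Hilbert space of square summable functions. -/
abbrev SqSum (α : Type) : Type := lp (fun _ : α => ℂ) 2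

theorem memlp_two_iff {f : α → ℂ} : Memℓp f 2 ↔ Summable fun x => ‖f x‖ ^ 2 := by
  rw [memℓp_gen_iff (by norm_num)]
  simp

theorem summable_norm_sq (F : SqSum α) : Summable fun x => ‖F x‖ ^ 2 :=
  memlp_two_iff.1 (lp.memℓp F)

theorem norm_sq_eq_tsum (F : SqSum α) : ‖F‖ ^ 2 = ∑' x, ‖F x‖ ^ 2 := by
  have h := lp.norm_rpow_eq_tsum (p := 2) (by norm_num) F
  simpa using h

theorem norm_le_mul_of_tsum_le {F : SqSum α} {G : SqSum β} {C : ℝ} (hC : 0 ≤ C)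
    (h : ∑' x, ‖F x‖ ^ 2 ≤ C ^ 2 * ∑' x, ‖G x‖ ^ 2) : ‖F‖ ≤ C * ‖G‖ := by
  refine le_of_sq_le_sq ?_ (by positivity)
  rw [mul_pow, norm_sq_eq_tsum, norm_sq_eq_tsum]
  exact h

theorem norm_le_mul_of_pointwise {F G : SqSum α} {C : ℝ} (hC : 0 ≤ C)
    (h : ∀ x, ‖F x‖ ≤ C * ‖G x‖) : ‖F‖ ≤ C * ‖G‖ := by
  refine norm_le_mul_of_tsum_le hC ?_
  rw [← tsum_mul_left]
  refine (summable_norm_sq F).tsum_le_tsum (fun x => ?_) ((summable_norm_sq G).mul_left _)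
  rw [← mul_pow]
  exact pow_le_pow_left₀ (norm_nonneg _) (h x) 2

/-- Composition with an injective map. -/
def pullback (f : α → β) (hf : f.Injective) : SqSum β →L[ℂ] SqSum α :=
  LinearMap.mkContinuous
    { toFun := fun F => ⟨fun x => F (f x),
        memlp_two_iff.2 ((summable_norm_sq F).comp_injective hf)⟩
      map_add' := fun F G => lp.ext (funext fun x => rfl)
      map_smul' := fun c F => lp.ext (funext fun x => rfl) } 1
    (fun F => norm_le_mul_of_tsum_le zero_le_one (by
      rw [one_pow, one_mul]
      exact ((summable_norm_sq F).comp_injective hf).tsum_le_tsum_of_inj f hf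
        (fun _ _ => by positivity) (fun _ => le_rfl) (summable_norm_sq F)))

/-- If every slice of `F` is bounded by the slice of `G`, then so is `F`. -/
theorem norm_le_of_slices (Φ : γ × β ≃ α) {F G : SqSum α} {C : ℝ} (hC : 0 ≤ C)
    (h : ∀ c, ‖pullback (fun y => Φ (c, y)) (fun _ _ h => (Prod.ext_iff.1 (Φ.injective h)).2) F‖
      ≤ C * ‖pullback (fun y => Φ (c, y)) (fun _ _ h => (Prod.ext_iff.1 (Φ.injective h)).2) G‖) :
    ‖F‖ ≤ C * ‖G‖ := by
  have hs : ∀ H : SqSum α, Summable fun z : γ × β => ‖H (Φ z)‖ ^ 2 := fun H =>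
    (summable_norm_sq H).comp_injective Φ.injective
  refine norm_le_mul_of_tsum_le hC ?_
  rw [← Φ.tsum_eq, ← Φ.tsum_eq (fun x => ‖G x‖ ^ 2), (hs F).tsum_prod, (hs G).tsum_prod,
    ← tsum_mul_left]
  refine (hs F).prod.tsum_le_tsum (fun c => ?_) ((hs G).prod.mul_left _)
  have := pow_le_pow_left₀ (norm_nonneg _) (h c) 2
  rw [mul_pow, norm_sq_eq_tsum, norm_sq_eq_tsum] at this
  exact this

end Pullback

/-! ### Translations in ℓ₂ of an abelian group. -/

section Shift

variable {G : Type} [AddCommGroup G]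

/-- Translation by `g`. -/
def shift (g : G) : SqSum G →L[ℂ] SqSum G :=
  pullback (fun x => x - g) sub_left_injective

@[simp]
theorem shift_apply (g : G) (F : SqSum G) (x : G) : shift g F x = F (x - g) := rfl

theorem shift_zero : shift (0 : G) = 1 := by
  ext F x
  simp

theorem shift_mul_shift (g h : G) : shift g * shift h = shift (g + h) := by
  ext F x
  simp [sub_sub]

theorem norm_shift_apply (g : G) (F : SqSum G) : ‖shift g F‖ = ‖F‖ := by
  have : ‖shift g F‖ ^ 2 = ‖F‖ ^ 2 := by
    rw [norm_sq_eq_tsum, norm_sq_eq_tsum]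
    exact (Equiv.subRight g).tsum_eq (fun x => ‖F x‖ ^ 2)
  exact (pow_left_inj₀ (norm_nonneg _) (norm_nonneg _) two_ne_zero).1 this

theorem norm_shift_le (g : G) : ‖shift g‖ ≤ 1 :=
  ContinuousLinearMap.opNorm_le_bound _ zero_le_one fun F => by rw [norm_shift_apply, one_mul]

theorem star_shift (g : G) : star (shift g) = shift (-g) := by
  rw [ContinuousLinearMap.star_eq_adjoint]
  symm
  rw [ContinuousLinearMap.eq_adjoint_iff]
  intro F F'
  rw [lp.inner_eq_tsum, lp.inner_eq_tsum, ← (Equiv.subRight g).tsum_eq]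
  simp

/-- A nontrivial translation has no eigenvector in `ℓ₂`. -/
theorem eq_zero_of_shift_eq_smul [IsAddTorsionFree G] {g : G} (hg : g ≠ 0) {F : SqSum G} {z : ℂ}
    (h : shift g F = z • F) : F = 0 := by
  by_contra hF
  -- An isometry has only unimodular eigenvalues, so |F| is constant along the orbit x - n g. This
  -- orbit is infinite because there is no torsion, and square summability forces the constant to be
  -- zero.
  have hz : ‖z‖ = 1 := by
    have h1 := norm_shift_apply g F
    rw [h, norm_smul] at h1
    exact mul_right_cancel₀ (norm_ne_zero_iff.2 hF) (by rw [h1, one_mul])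
  have h2 : ∀ x, ‖F (x - g)‖ = ‖F x‖ := fun x => by
    rw [← shift_apply, h]
    simp [hz]
  have h3 : ∀ (n : ℕ) x, ‖F (x - n • g)‖ = ‖F x‖ := fun n => by
    induction n with
    | zero => simp
    | succ n ih => intro x; rw [succ_nsmul, ← sub_sub, h2, ih]
  refine hF (lp.ext (funext fun x => ?_))
  have h4 : Function.Injective fun n : ℕ => x - n • g := fun m n hmn => by
    have h7 : m • g = n • g := sub_right_injective hmn
    rw [← natCast_zsmul, ← natCast_zsmul] at h7
    exact Int.natCast_inj.1 (smul_left_injective ℤ hg h7)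
  have h5 := ((summable_norm_sq F).comp_injective h4).tendsto_atTop_zero
  simp only [Function.comp_def, h3] at h5
  have h6 := tendsto_nhds_unique h5 tendsto_const_nhds
  simpa using h6.symm

end Shift

/-! ### Multiplication operators in ℓ₂. -/

section LatticeMul

variable {σ : Type}

theorem latticeMul_apply {w : (σ → ℤ) → ℂ} (hw : ∃ M : ℝ, ∀ x, ‖w x‖ ≤ M) (F : LatticeL2 σ)
    (x : σ → ℤ) : latticeMul w F x = w x * F x := by
  unfold latticeMul
  rw [dif_pos hw]
  rfl

theorem isSelfAdjoint_latticeMul {w : (σ → ℤ) → ℝ} (hw : ∃ M : ℝ, ∀ x, ‖(w x : ℂ)‖ ≤ M) :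
    IsSelfAdjoint (latticeMul fun x => (w x : ℂ)) := by
  rw [IsSelfAdjoint, ContinuousLinearMap.star_eq_adjoint]
  symm
  rw [ContinuousLinearMap.eq_adjoint_iff]
  intro F F'
  rw [lp.inner_eq_tsum, lp.inner_eq_tsum]
  refine tsum_congr fun x => ?_
  rw [latticeMul_apply hw, latticeMul_apply hw]
  simp
  ring

theorem latticeMul_commute {w w' : (σ → ℤ) → ℂ} (hw : ∃ M : ℝ, ∀ x, ‖w x‖ ≤ M)
    (hw' : ∃ M : ℝ, ∀ x, ‖w' x‖ ≤ M) : Commute (latticeMul w) (latticeMul w') := by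
  refine ContinuousLinearMap.ext fun F => lp.ext (funext fun x => ?_)
  simp only [mul_apply_eq_comp, latticeMul_apply hw, latticeMul_apply hw']
  ring

theorem shift_commute_latticeMul {w : (σ → ℤ) → ℂ} (hw : ∃ M : ℝ, ∀ x, ‖w x‖ ≤ M) {g : σ → ℤ}
    (h : ∀ x, w (x - g) = w x) : Commute (shift g) (latticeMul w) := by
  refine ContinuousLinearMap.ext fun F => lp.ext (funext fun x => ?_)
  simp only [mul_apply_eq_comp, latticeMul_apply hw, shift_apply, h]

end LatticeMul

/-! ### Summability of products -/

/-- Every finite set of tuples lies in a finite box, over which the sum of products factorises; the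
product of the full sums therefore bounds all partial sums. -/
theorem summable_prod_pi {κ : Type} [Fintype κ] {α : κ → Type} {f : ∀ c, α c → ℝ}
    (h0 : ∀ c y, 0 ≤ f c y) (hf : ∀ c, Summable (f c)) :
    Summable fun y : ∀ c, α c => ∏ c, f c (y c) := by
  classical
  refine summable_of_sum_le (c := ∏ c, ∑' y, f c y)
    (fun y => Finset.prod_nonneg fun c _ => h0 c _) fun s => ?_
  have hs : s ⊆ Fintype.piFinset fun c => s.image fun y => y c := fun y hy =>
    Fintype.mem_piFinset.2 fun c => Finset.mem_image_of_mem (fun y : ∀ c, α c => y c) hy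
  refine (Finset.sum_le_sum_of_subset_of_nonneg hs
    fun y _ _ => Finset.prod_nonneg fun c _ => h0 c _).trans ?_
  rw [← Finset.prod_univ_sum]
  exact Finset.prod_le_prod (fun c _ => Finset.sum_nonneg fun y _ => h0 c y)
    fun c _ => (hf c).sum_le_tsum _ fun y _ => h0 c y

theorem summable_pow_natAbs {r : ℝ} (h0 : 0 ≤ r) (h1 : r < 1) :
    Summable fun n : ℤ => r ^ n.natAbs := by
  refine Summable.of_nat_of_neg ?_ ?_ <;> simpa using summable_geometric_of_lt_one h0 h1

/-! ### Approximate eigenvectors -/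

section ApproximateEigenvectors

variable {E : Type} [NormedAddCommGroup E] [InnerProductSpace ℂ E]

/-- The unit vectors `f n` are, in the limit, eigenvectors of `A` with eigenvalue `z`. -/
def ApproxEigen {ν : Type*} (l : Filter ν) (f : ν → E) (A : E →L[ℂ] E) (z : ℂ) : Prop :=
  Tendsto (fun n => A (f n) - z • f n) l (𝓝 0)

variable {ν : Type*} {l : Filter ν} {f : ν → E}

theorem ApproxEigen.sum {κ : Type*} {s : Finset κ} {A : κ → E →L[ℂ] E} {z : κ → ℂ}
    (h : ∀ c ∈ s, ApproxEigen l f (A c) (z c)) :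
    ApproxEigen l f (∑ c ∈ s, A c) (∑ c ∈ s, z c) := by
  have := tendsto_finsetSum s h
  simp only [Finset.sum_const_zero] at this
  refine this.congr fun n => ?_
  simp [Finset.sum_smul]

theorem ApproxEigen.add {A B : E →L[ℂ] E} {z w : ℂ} (hA : ApproxEigen l f A z)
    (hB : ApproxEigen l f B w) : ApproxEigen l f (A + B) (z + w) := by
  have := Tendsto.add hA hB
  rw [add_zero] at this
  refine this.congr fun n => ?_
  simp only [add_apply, add_smul]
  abel

theorem ApproxEigen.mul {A B : E →L[ℂ] E} {z w : ℂ} (hA : ApproxEigen l f A z)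
    (hB : ApproxEigen l f B w) : ApproxEigen l f (A * B) (z * w) := by
  have h1 := ((A.continuous.tendsto 0).comp hB).add (hA.const_smul w)
  rw [map_zero, smul_zero, add_zero] at h1
  refine h1.congr fun n => ?_
  simp only [Function.comp_apply, map_sub, map_smul, mul_apply_eq_comp, smul_sub, smul_smul]
  rw [mul_comm w z]
  abel

theorem ApproxEigen.eq [l.NeBot] (hf : ∀ n, ‖f n‖ = 1) {A : E →L[ℂ] E} {z w : ℂ}
    (hz : ApproxEigen l f A z) (hw : ApproxEigen l f A w) : z = w := by
  have h1 := (hw.sub hz).norm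
  rw [sub_zero, norm_zero] at h1
  have h2 : ∀ n, ‖A (f n) - w • f n - (A (f n) - z • f n)‖ = ‖z - w‖ := fun n => by
    rw [sub_sub_sub_cancel_left, ← sub_smul, norm_smul, hf, mul_one]
  simp only [h2] at h1
  exact sub_eq_zero.1 (norm_eq_zero.1 (tendsto_nhds_unique tendsto_const_nhds h1))

theorem ApproxEigen.norm_eq_one [l.NeBot] (hf : ∀ n, ‖f n‖ = 1) {A : E →L[ℂ] E} {z : ℂ}
    (hA : ∀ F, ‖A F‖ = ‖F‖) (hz : ApproxEigen l f A z) : ‖z‖ = 1 := by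
  have h1 : Tendsto (fun n => ‖A (f n)‖ - ‖z • f n‖) l (𝓝 0) :=
    squeeze_zero_norm (fun n => abs_norm_sub_norm_le _ _) (tendsto_zero_iff_norm_tendsto_zero.1 hz)
  simp only [hA, hf, norm_smul, mul_one] at h1
  exact (sub_eq_zero.1 (tendsto_nhds_unique tendsto_const_nhds h1)).symm

theorem ApproxEigen.one : ApproxEigen l f 1 1 :=
  tendsto_const_nhds.congr fun n => by simp

theorem ApproxEigen.exists_lt [l.NeBot] (hf : ∀ n, ‖f n‖ = 1) {A : E →L[ℂ] E} {z : ℂ}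
    (h : ApproxEigen l f A z) {ε : ℝ} (hε : 0 < ε) :
    ∃ F : E, F ≠ 0 ∧ ‖A F - z • F‖ < ε * ‖F‖ := by
  obtain ⟨n, hn⟩ := ((tendsto_zero_iff_norm_tendsto_zero.1 h).eventually (gt_mem_nhds hε)).exists
  refine ⟨f n, fun h0 => ?_, by rwa [hf n, mul_one]⟩
  have := hf n
  rw [h0, norm_zero] at this
  exact zero_ne_one this

/-- A bounded inverse of z - A would send the null family A f - z f to -f, whose norm is 1. -/
theorem ApproxEigen.mem_spectrum [l.NeBot] (hf : ∀ n, ‖f n‖ = 1) {A : E →L[ℂ] E} {z : ℂ}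
    (h : ApproxEigen l f A z) : z ∈ spectrum ℂ A := by
  intro hu
  obtain ⟨u, hu⟩ := hu
  have h1 : Tendsto (fun n => (↑u⁻¹ : E →L[ℂ] E) (A (f n) - z • f n)) l (𝓝 0) := by
    have := ((↑u⁻¹ : E →L[ℂ] E).continuous.tendsto 0).comp h
    rwa [map_zero] at this
  have h2 : ∀ n, (↑u⁻¹ : E →L[ℂ] E) (A (f n) - z • f n) = - f n := fun n => by
    have h3 : A (f n) - z • f n = - (u : E →L[ℂ] E) (f n) := by
      rw [hu]
      simp [Algebra.algebraMap_eq_smul_one]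
    rw [h3, map_neg, ← mul_apply_eq_comp, Units.inv_mul]
    rfl
  have h4 := h1.norm
  simp only [h2, norm_neg, hf, norm_zero] at h4
  exact one_ne_zero (tendsto_nhds_unique tendsto_const_nhds h4)

variable [CompleteSpace E]

/-- The quadratic form of an operator that is not invertible takes arbitrarily small values at unit
vectors. -/
theorem exists_norm_lt_of_not_isUnit {B : E →L[ℂ] E}
    (h : ¬ IsUnit B) {c : ℝ} (hc : 0 < c) : ∃ F : E, ‖F‖ = 1 ∧ ‖inner ℂ (B F) F‖ < c := by
  by_contra! H
  -- Lax–Milgram: a lower bound of the quadratic form implies invertibility. The bound on unit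
  -- vectors extends to all vectors by homogeneity.
  refine h (ContinuousLinearMap.isUnit_of_forall_le_norm_inner_map B (c := ⟨c, hc.le⟩) hc
    fun F => ?_)
  rcases eq_or_ne F 0 with rfl | hF
  · simp
  have hF' : ‖F‖ ≠ 0 := norm_ne_zero_iff.2 hF
  have h1 := H ((‖F‖⁻¹ : ℂ) • F) (by
    rw [norm_smul]
    simp [hF'])
  rw [map_smul, inner_smul_left, inner_smul_right, norm_mul, norm_mul] at h1
  simp only [RCLike.norm_conj, norm_inv, Complex.norm_real, norm_norm] at h1
  change ‖F‖ ^ 2 * c ≤ _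
  calc ‖F‖ ^ 2 * c ≤ ‖F‖ ^ 2 * (‖F‖⁻¹ * (‖F‖⁻¹ * ‖inner ℂ (B F) F‖)) := by gcongr
    _ = _ := by field_simp

/-- Since z is real, B = A - z is self-adjoint and ⟨B²F, F⟩ = ‖BF‖². With B, also B² fails to be
invertible, so its quadratic form takes values below c² at unit vectors. -/
theorem exists_norm_sub_lt_of_mem_spectrum {A : E →L[ℂ] E} (hA : IsSelfAdjoint A) {z : ℂ}
    (hz : z ∈ spectrum ℂ A) {c : ℝ} (hc : 0 < c) :
    ∃ F : E, F ≠ 0 ∧ ‖A F - z • F‖ ≤ c * ‖F‖ := by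
  have hzz : conj z = z := by
    rw [Complex.conj_eq_iff_im]
    exact hA.im_eq_zero_of_mem_spectrum hz
  set B : E →L[ℂ] E := A - algebraMap ℂ _ z with hB
  have hB1 : ¬ IsUnit B := fun h => hz (by
    rw [spectrum.mem_resolventSet_iff, ← neg_sub]
    exact h.neg)
  have hBs : star B = B := by
    rw [hB, star_sub, hA.star_eq, ← algebraMap_star_comm]
    rw [show star z = z from hzz]
  have hB2 : ¬ IsUnit (B * B) := fun h => hB1 ((Commute.refl B).isUnit_mul_iff.1 h).1
  obtain ⟨F, hF1, hF2⟩ := exists_norm_lt_of_not_isUnit hB2 (show 0 < c ^ 2 by positivity)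
  refine ⟨F, fun h0 => ?_, ?_⟩
  · rw [h0, norm_zero] at hF1
    exact zero_ne_one hF1
  rw [hF1, mul_one]
  have h1 : inner ℂ ((B * B) F) F = inner ℂ (B F) (B F) := by
    rw [mul_apply_eq_comp]
    nth_rewrite 1 [← hBs]
    rw [ContinuousLinearMap.star_eq_adjoint, ContinuousLinearMap.adjoint_inner_left]
  rw [h1, inner_self_eq_norm_sq_to_K] at hF2
  have h2 : B F = A F - z • F := by simp [hB, Algebra.algebraMap_eq_smul_one]
  rw [← h2]
  refine (abs_le_of_sq_le_sq' ?_ hc.le).2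
  simpa using hF2.le

/-- Joint approximate eigenvectors of a commuting family. -/
theorem exists_joint_approxEigen {S : Set (E →L[ℂ] E)}
    (hcomm : ∀ a ∈ S, ∀ b ∈ S, Commute a b) (hstar : ∀ a ∈ S, star a ∈ S)
    {T : E →L[ℂ] E} (hT : T ∈ StarAlgebra.adjoin ℂ S) {z : ℂ} (hz : z ∈ spectrum ℂ T) :
    ∃ (ν : Type) (l : Filter ν) (f : ν → E), l.NeBot ∧ (∀ n, ‖f n‖ = 1) ∧
      ApproxEigen l f T z ∧ ∀ A ∈ S, ∃ w, ApproxEigen l f A w := by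
  classical
  have hc1 : ∀ a ∈ S, ∀ b ∈ S, a * b = b * a := fun a ha b hb => hcomm a ha b hb
  have hc2 : ∀ a ∈ S, ∀ b ∈ S, a * star b = star b * a := fun a ha b hb =>
    hcomm a ha _ (hstar b hb)
  let 𝒜₀ : StarSubalgebra ℂ (E →L[ℂ] E) := StarAlgebra.adjoin ℂ S
  let 𝒜 : StarSubalgebra ℂ (E →L[ℂ] E) := 𝒜₀.topologicalClosure
  have hcm : ∀ x y : 𝒜₀, x * y = y * x := (StarAlgebra.isMulCommutative_adjoin ℂ hc1 hc2).is_comm.comm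
  have hcl : IsClosed (𝒜 : Set (E →L[ℂ] E)) := 𝒜₀.isClosed_topologicalClosure
  let _ : CommCStarAlgebra 𝒜 :=
    { StarSubalgebra.cstarAlgebra 𝒜 with
      mul_comm := (𝒜₀.commRingTopologicalClosure hcm).mul_comm }
  have hS : 𝒜₀ ≤ 𝒜 := 𝒜₀.le_topologicalClosure
  -- Spectral permanence: passing to a closed star subalgebra does not change the spectrum, so
  -- Gelfand theory of the commutative algebra 𝒜 applies to T.
  have hz' : z ∈ spectrum ℂ (⟨T, hS hT⟩ : 𝒜) := by
    rw [StarSubalgebra.mem_spectrum_iff]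
    exact hz
  obtain ⟨φ, hφ⟩ := WeakDual.CharacterSpace.mem_spectrum_iff_exists.1 hz'
  let χ : 𝒜 →ₐ[ℂ] ℂ := WeakDual.CharacterSpace.toAlgHom φ
  let D : 𝒜 → 𝒜 := fun a => a - algebraMap ℂ 𝒜 (χ a)
  have hD : ∀ a, χ (D a) = 0 := fun a => by simp [D]
  have key : ∀ p : Finset 𝒜 × ℕ, ∃ F : E, ‖F‖ = 1 ∧
      ∀ a ∈ p.1, ‖(D a : E →L[ℂ] E) F‖ ^ 2 < 1 / ((p.2 : ℝ) + 1) := by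
    intro p
    -- The element b lies in the kernel of χ and hence is not invertible; its quadratic form is ∑ ‖D
    -- a F‖², so a small value controls all a in the finite set at once. The net is indexed by
    -- finite sets and precisions.
    let b : 𝒜 := ∑ a ∈ p.1, star (D a) * D a
    have hb0 : χ b = 0 := by simp [b, hD]
    have hb : ¬ IsUnit b := fun h => by
      have := h.map χ
      rw [hb0] at this
      exact not_isUnit_zero this
    rw [← StarSubalgebra.coe_isUnit] at hb
    obtain ⟨F, hF1, hF2⟩ := exists_norm_lt_of_not_isUnit hb
      (show (0 : ℝ) < 1 / ((p.2 : ℝ) + 1) by positivity)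
    refine ⟨F, hF1, fun a ha => lt_of_le_of_lt ?_ hF2⟩
    have h1 : inner ℂ ((b : E →L[ℂ] E) F) F
        = ((∑ a ∈ p.1, ‖(D a : E →L[ℂ] E) F‖ ^ 2 : ℝ) : ℂ) := by
      have h2 : (b : E →L[ℂ] E) = ∑ a ∈ p.1, star (D a : E →L[ℂ] E) * (D a : E →L[ℂ] E) := by
        simp [b]
      rw [h2, sum_apply, sum_inner, Complex.ofReal_sum]
      refine Finset.sum_congr rfl fun a _ => ?_
      rw [mul_apply_eq_comp, ContinuousLinearMap.star_eq_adjoint,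
        ContinuousLinearMap.adjoint_inner_left, inner_self_eq_norm_sq_to_K]
      simp
    rw [h1, Complex.norm_real, Real.norm_of_nonneg (by positivity)]
    exact Finset.single_le_sum (f := fun a : 𝒜 => ‖(D a : E →L[ℂ] E) F‖ ^ 2)
      (fun _ _ => by positivity) ha
  choose f hf1 hf2 using key
  suffices H : ∀ A : 𝒜, ApproxEigen atTop f (A : E →L[ℂ] E) (χ A) from
    ⟨Finset 𝒜 × ℕ, atTop, f, inferInstance, hf1, hφ ▸ H ⟨T, hS hT⟩,
      fun A hA => ⟨_, H ⟨A, hS (StarAlgebra.subset_adjoin ℂ S hA)⟩⟩⟩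
  intro A
  have h1 : Tendsto (fun p => ‖(D A : E →L[ℂ] E) (f p)‖ ^ 2) atTop (𝓝 0) := by
    refine tendsto_of_tendsto_of_tendsto_of_le_of_le' tendsto_const_nhds
      (tendsto_one_div_add_atTop_nhds_zero_nat.comp (tendsto_snd.mono_left
        (prod_atTop_atTop_eq (α := Finset 𝒜) (β := ℕ)).ge))
      (.of_forall fun _ => by positivity) ?_
    filter_upwards [eventually_ge_atTop (({A} : Finset 𝒜), 0)] with p hp
    exact (hf2 p A (hp.1 (Finset.mem_singleton_self A))).le
  have h2 : Tendsto (fun p => ‖(D A : E →L[ℂ] E) (f p)‖) atTop (𝓝 0) := by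
    have := h1.sqrt
    simpa [Real.sqrt_sq] using this
  refine (tendsto_zero_iff_norm_tendsto_zero.2 h2).congr fun p => ?_
  simp [D, Algebra.algebraMap_eq_smul_one]

end ApproximateEigenvectors

/-! ### The Hamiltonian in the position representation -/

section PositionRepresentation

theorem continuousMul_coeFn {X : Type} [TopologicalSpace X] [CompactSpace X] [MeasurableSpace X]
    [BorelSpace X] (μ : Measure X) [IsFiniteMeasure μ] (g : C(X, ℂ)) (f : Lp ℂ 2 μ) :
    continuousMul μ g f =ᵐ[μ] fun x => g x * f x := by
  refine (ContinuousLinearMap.coeFn_holder (r := 2) (ContinuousLinearMap.mul ℂ ℂ)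
    (ContinuousMap.toLp ∞ μ ℂ g) f).trans ?_
  filter_upwards [ContinuousMap.coeFn_toLp (p := ∞) (𝕜 := ℂ) μ g] with x hx
  rw [hx]
  rfl

/-- Multiplication by a continuous function, as a continuous linear function of its symbol. -/
def continuousMulL {X : Type} [TopologicalSpace X] [CompactSpace X] [MeasurableSpace X]
    [BorelSpace X] (μ : Measure X) [IsFiniteMeasure μ] : C(X, ℂ) →L[ℂ] (Lp ℂ 2 μ →L[ℂ] Lp ℂ 2 μ) :=
  ((ContinuousLinearMap.mul ℂ ℂ).holderL μ ∞ 2 2).comp (ContinuousMap.toLp ∞ μ ℂ)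

theorem continuousMulL_apply {X : Type} [TopologicalSpace X] [CompactSpace X] [MeasurableSpace X]
    [BorelSpace X] (μ : Measure X) [IsFiniteMeasure μ] (g : C(X, ℂ)) :
    continuousMulL μ g = continuousMul μ g := rfl

/-- Moving the character to the other side of the inner product turns the x-th Fourier coefficient
into the (x - n)-th. -/
theorem fourierTransform_symm_continuousMul_mFourier {σ : Type} [Fintype σ] (n : σ → ℤ)
    (f : TorusL2 σ) :
    (fourierTransform σ).symm (continuousMul (torusMeasure σ) (UnitAddTorus.mFourier n) f)
      = shift n ((fourierTransform σ).symm f) := by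
  refine lp.ext (funext fun x => ?_)
  rw [shift_apply]
  change (characterBasis σ).repr _ x = (characterBasis σ).repr f (x - n)
  rw [HilbertBasis.repr_apply_apply, HilbertBasis.repr_apply_apply, L2.inner_def, L2.inner_def,
    characterBasis_apply, characterBasis_apply]
  refine integral_congr_ae ?_
  filter_upwards [continuousMul_coeFn (torusMeasure σ) (UnitAddTorus.mFourier n) f,
    ContinuousMap.coeFn_toLp (p := 2) (𝕜 := ℂ) (torusMeasure σ) (UnitAddTorus.mFourier x),
    ContinuousMap.coeFn_toLp (p := 2) (𝕜 := ℂ) (torusMeasure σ) (UnitAddTorus.mFourier (x - n))]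
    with p h1 h2 h3
  rw [h1, h2, h3, RCLike.inner_apply, RCLike.inner_apply, ← UnitAddTorus.mFourier_neg,
    ← UnitAddTorus.mFourier_neg, neg_sub, sub_eq_add_neg, UnitAddTorus.mFourier_add]
  ring

variable {ι : Type} [Fintype ι] [LinearOrder ι] [Nonempty ι] {d : ℕ}

theorem fiberUnitary_continuousMul (k : UnitAddTorus (Fin d)) (g : C(Fiber ι k, ℂ))
    (f : FiberL2 ι k) :
    fiberUnitary k (continuousMul (fiberMeasure ι k) g f)
      = continuousMul (torusMeasure (Others ι × Fin d))
        (g.comp ⟨(omitLast k).symm, (omitLast k).symm.continuous⟩) (fiberUnitary k f) := by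
  have hm := measurePreserving_omitLast_symm (ι := ι) k
  refine Lp.ext ?_
  have h1 : ∀ f : FiberL2 ι k, fiberUnitary k f =ᵐ[torusMeasure (Others ι × Fin d)]
      f ∘ (omitLast k).symm := fun f => Lp.coeFn_compMeasurePreserving f hm
  filter_upwards [h1 f, h1 (continuousMul (fiberMeasure ι k) g f),
    hm.quasiMeasurePreserving.ae_eq_comp (continuousMul_coeFn (fiberMeasure ι k) g f),
    continuousMul_coeFn (torusMeasure (Others ι × Fin d))
      (g.comp ⟨(omitLast k).symm, (omitLast k).symm.continuous⟩) (fiberUnitary k f)]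
    with p h2 h3 h4 h5
  rw [h3, h5, h4, h2]
  rfl

/-- The translation of the relative positions when the particle `i` moves by `s`. -/
def hop (i : ι) : (Fin d → ℤ) →+ (Others ι × Fin d → ℤ) where
  toFun s := fun m => ((if m.1.1 = i then 1 else 0) - (if i = lastParticle ι then 1 else 0)) * s m.2
  map_zero' := by ext; simp
  map_add' s t := by ext; simp [mul_add]

theorem hop_apply (i : ι) (s : Fin d → ℤ) (m : Others ι × Fin d) : hop i s m =
    ((if m.1.1 = i then 1 else 0) - (if i = lastParticle ι then 1 else 0)) * s m.2 := rfl

/-- The factor by which the total quasi-momentum enters when the particle `i` moves by `s`. -/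
def phase (k : UnitAddTorus (Fin d)) (i : ι) (s : Fin d → ℤ) : ℂ :=
  if i = lastParticle ι then UnitAddTorus.mFourier s k else 1

theorem position_last (x : Others ι × Fin d → ℤ) : position x (lastParticle ι) = 0 := by
  ext a
  simp [position]

theorem position_of_ne (x : Others ι × Fin d → ℤ) {i : ι} (h : i ≠ lastParticle ι) (a : Fin d) :
    position x i a = x (⟨i, h⟩, a) := by
  simp [position, h]

/-- The last particle is the origin, so when it moves by s all others are displaced by -s. The
coefficient also covers j = i = last, where the two terms cancel. -/
theorem position_hop (i j : ι) (s : Fin d → ℤ) :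
    position (hop i s) j
      = ((if j = i then 1 else 0) - (if i = lastParticle ι then 1 else 0) : ℤ) • s := by
  ext a
  by_cases h : j = lastParticle ι
  · subst h
    simp [position, eq_comm]
  · rw [position_of_ne _ h, hop_apply]
    simp

theorem position_add (x y : Others ι × Fin d → ℤ) (i : ι) :
    position (x + y) i = position x i + position y i := by
  ext a
  by_cases h : i ≠ lastParticle ι <;> simp [position, h]

theorem norm_mFourier_apply {σ : Type} [Fintype σ] (n : σ → ℤ) (x : UnitAddTorus σ) :
    ‖UnitAddTorus.mFourier n x‖ = 1 := by
  simp only [UnitAddTorus.mFourier, ContinuousMap.coe_mk, norm_prod, fourier_apply, Circle.norm_coe,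
    Finset.prod_const_one]

theorem mFourier_apply_add {σ : Type} [Fintype σ] (n : σ → ℤ) (x y : UnitAddTorus σ) :
    UnitAddTorus.mFourier n (x + y) = UnitAddTorus.mFourier n x * UnitAddTorus.mFourier n y := by
  simp [UnitAddTorus.mFourier, ← Finset.prod_mul_distrib, AddCircle.toCircle_add]

theorem mFourier_apply_zero {σ : Type} [Fintype σ] (n : σ → ℤ) :
    UnitAddTorus.mFourier n (0 : UnitAddTorus σ) = 1 := by
  simp [UnitAddTorus.mFourier]

theorem mFourier_apply_sum {σ κ : Type} [Fintype σ] (n : σ → ℤ) (t : Finset κ)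
    (x : κ → UnitAddTorus σ) :
    UnitAddTorus.mFourier n (∑ c ∈ t, x c) = ∏ c ∈ t, UnitAddTorus.mFourier n (x c) := by
  classical
  induction t using Finset.induction_on with
  | empty => simp [mFourier_apply_zero]
  | insert a t ha ih => rw [Finset.sum_insert ha, Finset.prod_insert ha, mFourier_apply_add, ih]

theorem mFourier_apply_neg {σ : Type} [Fintype σ] (n : σ → ℤ) (x : UnitAddTorus σ) :
    UnitAddTorus.mFourier n (-x) = UnitAddTorus.mFourier (-n) x := by
  simp [UnitAddTorus.mFourier, AddCircle.toCircle_neg]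

/-- The last quasi-momentum is k - ∑ q_m: this produces the factor e^{i(s,k)} and the displacement
-s of every other particle, which is what `phase` and `hop` record. -/
theorem mFourier_insertLast (k : UnitAddTorus (Fin d)) (q : UnitAddTorus (Others ι × Fin d)) (i : ι)
    (s : Fin d → ℤ) : UnitAddTorus.mFourier s (insertLast k q i)
      = phase k i s * UnitAddTorus.mFourier (hop i s) q := by
  have h1 : UnitAddTorus.mFourier (hop i s) q
      = ∏ m : Others ι, UnitAddTorus.mFourier
        (((if m.1 = i then 1 else 0) - (if i = lastParticle ι then 1 else 0) : ℤ) • s)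
        fun a => q (m, a) := by
    simp only [UnitAddTorus.mFourier, ContinuousMap.coe_mk, Fintype.prod_prod_type, hop_apply,
      Pi.smul_apply, smul_eq_mul]
  by_cases h : i = lastParticle ι
  · rw [h1]
    have h2 : ∀ m : Others ι, ((if m.1 = i then 1 else 0)
        - (if i = lastParticle ι then 1 else 0) : ℤ) • s = -s := fun m => by
      rw [if_neg fun h3 => m.2 (h3.trans h), if_pos h, zero_sub, neg_one_zsmul]
    have h3 : insertLast k q i = k + -∑ m : Others ι, fun a => q (m, a) := by
      simp [insertLast, h, sub_eq_add_neg]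
    simp only [h2]
    rw [h3, mFourier_apply_add, mFourier_apply_neg, mFourier_apply_sum, phase, if_pos h]
  · rw [h1, Finset.prod_eq_single (⟨i, h⟩ : Others ι)]
    · simp [insertLast, h, phase]
    · intro m _ hm
      have : m.1 ≠ i := fun h3 => hm (Subtype.ext h3)
      simp [this, h, UnitAddTorus.mFourier_zero]
    · simp

/-- The kinetic energy of the particle `i`, in the position representation. -/
def latticeKinetic (e : (Fin d → ℤ) → ℂ) (k : UnitAddTorus (Fin d)) (i : ι) :
    LatticeL2 (Others ι × Fin d) →L[ℂ] LatticeL2 (Others ι × Fin d) :=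
  ∑' s, (e s * phase k i s) • shift (hop i s)

/-- The potential of the pair `i, j`, in the position representation. -/
def latticePotential (w : (Fin d → ℤ) → ℝ) (i j : ι) :
    LatticeL2 (Others ι × Fin d) →L[ℂ] LatticeL2 (Others ι × Fin d) :=
  latticeMul fun x => (w (position x i - position x j) : ℂ)

/-- The Schrödinger operator in the position representation. -/
def latticeHamiltonian (e : ι → (Fin d → ℤ) → ℂ) (v : ι → ι → (Fin d → ℤ) → ℝ)
    (k : UnitAddTorus (Fin d)) :
    LatticeL2 (Others ι × Fin d) →L[ℂ] LatticeL2 (Others ι × Fin d) :=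
  ∑ i, latticeKinetic (e i) k i
    - ∑ ij : ι × ι with ij.1 < ij.2, latticePotential (v ij.1 ij.2) ij.1 ij.2

variable (ι d) in
/-- Conjugation by the Fourier transform. -/
def fourierConj : (TorusL2 (Others ι × Fin d) →L[ℂ] TorusL2 (Others ι × Fin d)) ≃A[ℂ]
    (LatticeL2 (Others ι × Fin d) →L[ℂ] LatticeL2 (Others ι × Fin d)) :=
  (fourierTransform (Others ι × Fin d)).symm.toContinuousLinearEquiv.conjContinuousAlgEquiv

/-- Conjugation by the unitary operator that omits the last particle. -/
def fiberConj (k : UnitAddTorus (Fin d)) : (FiberL2 ι k →L[ℂ] FiberL2 ι k) ≃A[ℂ]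
    (TorusL2 (Others ι × Fin d) →L[ℂ] TorusL2 (Others ι × Fin d)) :=
  (fiberUnitary (ι := ι) k).toContinuousLinearEquiv.conjContinuousAlgEquiv

theorem fourierConj_potential (w : (Fin d → ℤ) → ℝ) (i j : ι) :
    fourierConj ι d (potential w i j) = latticePotential w i j := by
  refine ContinuousLinearMap.ext fun F => ?_
  change (fourierTransform _).symm (fourierTransform _ (latticeMul _
    ((fourierTransform _).symm (fourierTransform _ F)))) = _
  simp only [LinearIsometryEquiv.symm_apply_apply]
  rfl

theorem fiberConj_potential (w : (Fin d → ℤ) → ℝ) (i j : ι) (k : UnitAddTorus (Fin d)) :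
    fiberConj k (fiberPotential w i j k) = potential w i j := by
  refine ContinuousLinearMap.ext fun F => ?_
  change fiberUnitary k ((fiberUnitary k).symm (potential w i j
    (fiberUnitary k ((fiberUnitary k).symm F)))) = _
  simp only [LinearIsometryEquiv.apply_symm_apply]

/-- The series of the symbol converges absolutely in the uniform norm and all maps involved are
continuous and linear, so characters can be transported one at a time. -/
theorem fourierConj_fiberConj_kinetic {e : (Fin d → ℤ) → ℂ} (he : Summable fun s => ‖e s‖)
    (k : UnitAddTorus (Fin d)) (i : ι) :
    fourierConj ι d (fiberConj k (continuousMul (fiberMeasure ι k)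
      ((symbol e).comp ⟨fun p : Fiber ι k => p.1 i,
        (continuous_apply i).comp continuous_subtype_val⟩))) = latticeKinetic e k i := by
  have hs : HasSum (fun s => e s • UnitAddTorus.mFourier s) (symbol e) := by
    refine (Summable.of_norm ?_).hasSum
    simpa [norm_smul, UnitAddTorus.mFourier_norm] using he
  let π : C(Fiber ι k, UnitAddTorus (Fin d)) := ⟨fun p : Fiber ι k => p.1 i,
    (continuous_apply i).comp continuous_subtype_val⟩
  have h1 := (((hs.map (ContinuousMap.compRightAlgHom ℂ ℂ π)
    (ContinuousMap.compRightAlgHom_continuous ℂ ℂ π)).mapL (continuousMulL (fiberMeasure ι k))).map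
    (fiberConj k) (fiberConj k).continuous).map (fourierConj ι d) (fourierConj ι d).continuous
  refine h1.tsum_eq.symm.trans (tsum_congr fun s => ContinuousLinearMap.ext fun F => ?_)
  let U := fiberUnitary (ι := ι) k
  let 𝓕 := fourierTransform (Others ι × Fin d)
  have h2 : ((e s • UnitAddTorus.mFourier s : C(UnitAddTorus (Fin d), ℂ)).comp π).comp
      ⟨(omitLast k).symm, (omitLast k).symm.continuous⟩
      = (e s * phase k i s) • UnitAddTorus.mFourier (hop i s) := by
    ext q
    change e s * UnitAddTorus.mFourier s (insertLast k q i) = _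
    rw [mFourier_insertLast, ← mul_assoc]
    rfl
  calc 𝓕.symm (U (continuousMul (fiberMeasure ι k) ((e s • UnitAddTorus.mFourier s :
          C(UnitAddTorus (Fin d), ℂ)).comp π) (U.symm (𝓕 F))))
      = 𝓕.symm (continuousMul (torusMeasure (Others ι × Fin d))
          ((e s * phase k i s) • UnitAddTorus.mFourier (hop i s)) (𝓕 F)) := by
        rw [fiberUnitary_continuousMul, h2, LinearIsometryEquiv.apply_symm_apply]
    _ = (e s * phase k i s) • shift (hop i s) F := by
        rw [← continuousMulL_apply, map_smul, continuousMulL_apply,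
          smul_apply, map_smul,
          fourierTransform_symm_continuousMul_mFourier, LinearIsometryEquiv.symm_apply_apply]

theorem fourierConj_fiberConj_fiberHamiltonian {e : ι → (Fin d → ℤ) → ℂ}
    (he : ∀ i, Summable fun s => ‖e i s‖) (v : ι → ι → (Fin d → ℤ) → ℝ)
    (k : UnitAddTorus (Fin d)) :
    fourierConj ι d (fiberConj k (fiberHamiltonian e v k)) = latticeHamiltonian e v k := by
  rw [fiberHamiltonian, latticeHamiltonian, map_sub, map_sub, map_sum, map_sum]
  simp only [fiberConj_potential, fourierConj_potential]
  rw [← continuousMulL_apply, kineticSymbol, map_sum, map_sum, map_sum]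
  congr 1
  exact Finset.sum_congr rfl fun i _ => fourierConj_fiberConj_kinetic (he i) k i

theorem hamiltonian_eq (e : ι → (Fin d → ℤ) → ℂ) (v : ι → ι → (Fin d → ℤ) → ℝ)
    (k : UnitAddTorus (Fin d)) : hamiltonian e v k = fiberConj k (fiberHamiltonian e v k) := rfl

theorem spectrum_fiberHamiltonian {e : ι → (Fin d → ℤ) → ℂ}
    (he : ∀ i, Summable fun s => ‖e i s‖) (v : ι → ι → (Fin d → ℤ) → ℝ)
    (k : UnitAddTorus (Fin d)) :
    spectrum ℂ (fiberHamiltonian e v k) = spectrum ℂ (latticeHamiltonian e v k) := by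
  rw [← fourierConj_fiberConj_fiberHamiltonian he, AlgEquiv.spectrum_eq, AlgEquiv.spectrum_eq]

end PositionRepresentation

/-! ### Relative positions in a cluster -/

section ClusterGeometry

variable {N d : ℕ}

theorem le_lastParticle {ι : Type} [Fintype ι] [LinearOrder ι] [Nonempty ι] (i : ι) :
    i ≤ lastParticle ι :=
  Finset.le_max' _ _ (Finset.mem_univ i)

/-- The last particle of the cluster `c`. -/
def leader (c : Finset (Fin N)) [Nonempty {i : Fin N // i ∈ c}] : Fin N :=
  (lastParticle {i : Fin N // i ∈ c}).1

variable (c : Finset (Fin N)) [Nonempty {i : Fin N // i ∈ c}]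

theorem leader_mem : leader c ∈ c := (lastParticle {i : Fin N // i ∈ c}).2

variable {c} in
theorem coe_eq_leader_iff {i : {i : Fin N // i ∈ c}} :
    i.1 = leader c ↔ i = lastParticle {i : Fin N // i ∈ c} := Subtype.ext_iff.symm

variable [NeZero N]

theorem leader_eq_last_iff : leader c = lastParticle (Fin N) ↔ lastParticle (Fin N) ∈ c := by
  refine ⟨fun h => h ▸ leader_mem c, fun h => le_antisymm (le_lastParticle _) ?_⟩
  exact le_lastParticle (⟨_, h⟩ : {i : Fin N // i ∈ c})

variable {c} in
theorem coe_eq_last_iff {i : {i : Fin N // i ∈ c}} : i.1 = lastParticle (Fin N) ↔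
    i = lastParticle {i : Fin N // i ∈ c} ∧ lastParticle (Fin N) ∈ c := by
  rw [← coe_eq_leader_iff, ← leader_eq_last_iff]
  refine ⟨fun h => ?_, fun h => h.1.trans h.2⟩
  have := (leader_eq_last_iff c).2 (h ▸ i.2)
  exact ⟨h.trans this.symm, this⟩

theorem ext_position {ι : Type} [Fintype ι] [LinearOrder ι] [Nonempty ι]
    {x y : Others ι × Fin d → ℤ} (h : ∀ i, position x i = position y i) : x = y := by
  ext ⟨m, a⟩
  have := congrFun (h m.1) a
  rwa [position_of_ne _ m.2, position_of_ne _ m.2] at this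

theorem position_zero {ι : Type} [Fintype ι] [LinearOrder ι] [Nonempty ι] (i : ι) :
    position (0 : Others ι × Fin d → ℤ) i = 0 := by
  ext a
  simp [position]

/-- The position of the particle `i` as an additive map. -/
def positionHom {ι : Type} [Fintype ι] [LinearOrder ι] [Nonempty ι] (i : ι) :
    (Others ι × Fin d → ℤ) →+ (Fin d → ℤ) where
  toFun x := position x i
  map_zero' := position_zero i
  map_add' x y := position_add x y i

theorem position_sub {ι : Type} [Fintype ι] [LinearOrder ι] [Nonempty ι]
    (x y : Others ι × Fin d → ℤ) (i : ι) :
    position (x - y) i = position x i - position y i :=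
  map_sub (positionHom i) x y

theorem position_sum {ι κ : Type} [Fintype ι] [LinearOrder ι] [Nonempty ι] (t : Finset κ)
    (x : κ → Others ι × Fin d → ℤ) (i : ι) :
    position (∑ c ∈ t, x c) i = ∑ c ∈ t, position (x c) i :=
  map_sum (positionHom i) x t

open scoped Classical in
/-- Displacement of the particles of the cluster `c` relative to its last particle. -/
def embed : (Others {i : Fin N // i ∈ c} × Fin d → ℤ) →+ (Others (Fin N) × Fin d → ℤ) where
  toFun y := fun m => if h : m.1.1 ∈ c then position y ⟨m.1.1, h⟩ m.2 else 0
  map_zero' := by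
    ext m
    simp [position_zero]
  map_add' y y' := by
    ext m
    by_cases h : m.1.1 ∈ c <;> simp [h, position_add]

theorem position_embed_of_mem (y : Others {i : Fin N // i ∈ c} × Fin d → ℤ) {i : Fin N}
    (hi : i ∈ c) : position (embed c y) i = position y ⟨i, hi⟩ := by
  ext a
  by_cases h : i = lastParticle (Fin N)
  · have h1 : (⟨i, hi⟩ : {i : Fin N // i ∈ c}) = lastParticle _ :=
      (coe_eq_last_iff (i := ⟨i, hi⟩).1 h).1
    rw [h1, h, position_last, position_last]
  · rw [position_of_ne _ h]
    simp [embed, hi]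

theorem position_embed_of_notMem (y : Others {i : Fin N // i ∈ c} × Fin d → ℤ) {i : Fin N}
    (hi : i ∉ c) : position (embed c y) i = 0 := by
  ext a
  by_cases h : i = lastParticle (Fin N)
  · rw [h, position_last]
  · rw [position_of_ne _ h]
    simp [embed, hi]

theorem position_embed_leader (y : Others {i : Fin N // i ∈ c} × Fin d → ℤ) :
    position (embed c y) (leader c) = 0 := by
  rw [position_embed_of_mem c y (leader_mem c)]
  exact position_last y

/-- The positions of the particles of the cluster `c` relative to its last particle. -/
def rel : (Others (Fin N) × Fin d → ℤ) →+ (Others {i : Fin N // i ∈ c} × Fin d → ℤ) where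
  toFun x := fun m => (position x m.1.1.1 - position x (leader c)) m.2
  map_zero' := by
    ext m
    simp [position_zero]
  map_add' x y := by
    ext m
    simp only [position_add, Pi.add_apply, Pi.sub_apply]
    ring

theorem position_rel (x : Others (Fin N) × Fin d → ℤ) (i : {i : Fin N // i ∈ c}) :
    position (rel c x) i = position x i.1 - position x (leader c) := by
  ext a
  by_cases h : i = lastParticle _
  · rw [h, position_last]
    exact (sub_self _).symm
  · rw [position_of_ne _ h]
    rfl

theorem rel_embed (y : Others {i : Fin N // i ∈ c} × Fin d → ℤ) : rel c (embed c y) = y := by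
  refine ext_position fun i => ?_
  rw [position_rel, position_embed_leader, position_embed_of_mem c y i.2, sub_zero]

theorem rel_embed_of_disjoint {c' : Finset (Fin N)} [Nonempty {i : Fin N // i ∈ c'}]
    (h : Disjoint c c') (y : Others {i : Fin N // i ∈ c'} × Fin d → ℤ) :
    rel c (embed c' y) = 0 := by
  refine ext_position fun i => ?_
  rw [position_rel, position_embed_of_notMem c' y (Finset.disjoint_left.1 h i.2),
    position_embed_of_notMem c' y (Finset.disjoint_left.1 h (leader_mem c)), sub_zero,
    position_zero]

/-- A configuration is a configuration in which the cluster `c` is concentrated in one point,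
plus a relative displacement of the particles of `c`. -/
def splitEquiv : {b : Others (Fin N) × Fin d → ℤ // rel c b = 0} ×
    (Others {i : Fin N // i ∈ c} × Fin d → ℤ) ≃ (Others (Fin N) × Fin d → ℤ) where
  toFun z := z.1.1 + embed c z.2
  invFun x := ⟨⟨x - embed c (rel c x), by rw [map_sub, rel_embed, sub_self]⟩, rel c x⟩
  left_inv z := by
    have h : rel c (z.1.1 + embed c z.2) = z.2 := by rw [map_add, z.1.2, zero_add, rel_embed]
    refine Prod.ext (Subtype.ext ?_) h
    change z.1.1 + embed c z.2 - embed c (rel c (z.1.1 + embed c z.2)) = _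
    rw [h, add_sub_cancel_right]
  right_inv x := sub_add_cancel _ _

/-- Restriction to the configurations with cluster positions as in `b`. -/
def slice (b : {b : Others (Fin N) × Fin d → ℤ // rel c b = 0}) :
    LatticeL2 (Others (Fin N) × Fin d) →L[ℂ] LatticeL2 (Others {i : Fin N // i ∈ c} × Fin d) :=
  pullback (fun y => splitEquiv c (b, y))
    (fun _ _ h => (Prod.ext_iff.1 ((splitEquiv c).injective h)).2)

theorem slice_apply (b : {b : Others (Fin N) × Fin d → ℤ // rel c b = 0})
    (F : LatticeL2 (Others (Fin N) × Fin d)) (y : Others {i : Fin N // i ∈ c} × Fin d → ℤ) :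
    slice c b F y = F (b.1 + embed c y) := rfl

theorem norm_le_of_slice_le {F G : LatticeL2 (Others (Fin N) × Fin d)} {M : ℝ} (hM : 0 ≤ M)
    (h : ∀ b, ‖slice c b F‖ ≤ M * ‖slice c b G‖) : ‖F‖ ≤ M * ‖G‖ :=
  norm_le_of_slices (splitEquiv c) hM h

/-- The displacement of all particles when the cluster `c` moves by `s`. -/
def clusterHop (c : Finset (Fin N)) (s : Fin d → ℤ) : Others (Fin N) × Fin d → ℤ := ∑ i ∈ c, hop i s

theorem position_clusterHop (c : Finset (Fin N)) (s : Fin d → ℤ) (j : Fin N) : position (clusterHop c s) j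
    = ((if j ∈ c then 1 else 0) - (if lastParticle (Fin N) ∈ c then 1 else 0) : ℤ) • s := by
  rw [clusterHop, position_sum]
  simp only [position_hop]
  rw [← Finset.sum_smul, Finset.sum_sub_distrib, Finset.sum_ite_eq, Finset.sum_ite_eq']

theorem embed_hop_of_ne {j : {i : Fin N // i ∈ c}} (hj : j ≠ lastParticle _) (s : Fin d → ℤ) :
    embed c (hop j s) = hop j.1 s := by
  refine ext_position fun i => ?_
  have h1 : j.1 ≠ lastParticle (Fin N) := fun h => hj (coe_eq_last_iff.1 h).1
  by_cases hi : i ∈ c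
  · rw [position_embed_of_mem c _ hi, position_hop, position_hop]
    simp [hj, h1, Subtype.ext_iff]
  · rw [position_embed_of_notMem c _ hi, position_hop]
    have : i ≠ j.1 := fun h => hi (h ▸ j.2)
    simp [h1, this]

/-- Moving the leader by s amounts to moving the whole cluster by s and all its other members back
by -s. The second move is, relative to the leader, a hop of the last particle of the cluster. This
separates the motion of the cluster from its internal motion. -/
theorem hop_leader (s : Fin d → ℤ) :
    hop (leader c) s = clusterHop c s + embed c (hop (lastParticle {i : Fin N // i ∈ c}) s) := by
  refine ext_position fun i => ?_
  rw [position_add, position_clusterHop, position_hop]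
  by_cases hi : i ∈ c
  · rw [position_embed_of_mem c _ hi, position_hop, ← add_smul]
    simp only [← coe_eq_leader_iff, hi, leader_eq_last_iff]
    congr 1
    simp
  · rw [position_embed_of_notMem c _ hi]
    have : i ≠ leader c := fun h => hi (h ▸ leader_mem c)
    simp [hi, this, leader_eq_last_iff]

end ClusterGeometry

/-! ### The parts of the cluster operator -/

section ClusterParts

theorem norm_phase {ι : Type} [Fintype ι] [LinearOrder ι] [Nonempty ι] {d : ℕ}
    (k : UnitAddTorus (Fin d)) (i : ι) (s : Fin d → ℤ) : ‖phase k i s‖ = 1 := by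
  unfold phase
  split_ifs
  · exact norm_mFourier_apply s k
  · exact norm_one

theorem summable_smul_shift {S G : Type} [AddCommGroup G] {e θ : S → ℂ}
    (he : Summable fun s => ‖e s‖) (hθ : ∀ s, ‖θ s‖ = 1) (g : S → G) :
    Summable fun s => (e s * θ s) • shift (g s) := by
  refine Summable.of_norm_bounded he fun s => ?_
  rw [norm_smul, norm_mul, hθ, mul_one]
  exact mul_le_of_le_one_right (norm_nonneg _) (norm_shift_le _)

theorem tsum_smul_shift_apply {S G : Type} [AddCommGroup G] {e θ : S → ℂ}
    (he : Summable fun s => ‖e s‖) (hθ : ∀ s, ‖θ s‖ = 1) (g : S → G) (F : SqSum G) :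
    HasSum (fun s => (e s * θ s) • shift (g s) F) ((∑' s, (e s * θ s) • shift (g s)) F) :=
  (summable_smul_shift he hθ g).hasSum.mapL
    (ContinuousLinearMap.apply ℂ (SqSum G) F)

variable {N d : ℕ} [NeZero N] (c : Finset (Fin N)) [Nonempty {i : Fin N // i ∈ c}]

/-- The part of the Hamiltonian that concerns the particles of the cluster `c`. -/
def clusterPart (e : Fin N → (Fin d → ℤ) → ℂ) (v : Fin N → Fin N → (Fin d → ℤ) → ℝ)
    (K : UnitAddTorus (Fin d)) :
    LatticeL2 (Others (Fin N) × Fin d) →L[ℂ] LatticeL2 (Others (Fin N) × Fin d) :=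
  ∑ j : {i : Fin N // i ∈ c}, latticeKinetic (e j) K j.1
    - ∑ ij : {i : Fin N // i ∈ c} × {i : Fin N // i ∈ c} with ij.1 < ij.2,
      latticePotential (v ij.1 ij.2) ij.1.1 ij.2.1

/-- The Hamiltonian of the cluster `c` with total quasi-momentum `k`, acting on all particles. -/
def frozenPart (e : Fin N → (Fin d → ℤ) → ℂ) (v : Fin N → Fin N → (Fin d → ℤ) → ℝ)
    (k : UnitAddTorus (Fin d)) :
    LatticeL2 (Others (Fin N) × Fin d) →L[ℂ] LatticeL2 (Others (Fin N) × Fin d) :=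
  ∑ j : {i : Fin N // i ∈ c}, ∑' s, (e j s * phase k j s) • shift (embed c (hop j s))
    - ∑ ij : {i : Fin N // i ∈ c} × {i : Fin N // i ∈ c} with ij.1 < ij.2,
      latticePotential (v ij.1 ij.2) ij.1.1 ij.2.1

/-- The factor by which the total quasi-momentum enters when the cluster `c` moves by `s`. -/
def clusterPhase (c : Finset (Fin N)) (K : UnitAddTorus (Fin d)) (s : Fin d → ℤ) : ℂ :=
  if lastParticle (Fin N) ∈ c then UnitAddTorus.mFourier s K else 1

/-- Translation of the cluster `c` by `s`. -/
def clusterShift (c : Finset (Fin N)) (K : UnitAddTorus (Fin d)) (s : Fin d → ℤ) :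
    LatticeL2 (Others (Fin N) × Fin d) →L[ℂ] LatticeL2 (Others (Fin N) × Fin d) :=
  clusterPhase c K s • shift (clusterHop c s)

variable {e : Fin N → (Fin d → ℤ) → ℂ} {v : Fin N → Fin N → (Fin d → ℤ) → ℝ}

theorem phase_leader (K : UnitAddTorus (Fin d)) (s : Fin d → ℤ) :
    phase K (leader c) s = clusterPhase c K s := by
  simp [phase, clusterPhase, leader_eq_last_iff]

theorem norm_clusterPhase (K : UnitAddTorus (Fin d)) (s : Fin d → ℤ) :
    ‖clusterPhase c K s‖ = 1 := by
  rw [← phase_leader, norm_phase]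

theorem norm_clusterShift_apply (K : UnitAddTorus (Fin d)) (s : Fin d → ℤ)
    (F : LatticeL2 (Others (Fin N) × Fin d)) : ‖clusterShift c K s F‖ = ‖F‖ := by
  rw [clusterShift, smul_apply, norm_smul, norm_clusterPhase, one_mul, norm_shift_apply]

theorem slice_shift_embed (b : {b : Others (Fin N) × Fin d → ℤ // rel c b = 0})
    (g : Others {i : Fin N // i ∈ c} × Fin d → ℤ) (F : LatticeL2 (Others (Fin N) × Fin d)) :
    slice c b (shift (embed c g) F) = shift g (slice c b F) := by
  refine lp.ext (funext fun y => ?_)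
  rw [slice_apply, shift_apply, shift_apply, slice_apply, map_sub, add_sub_assoc]

/-- In b the particles of c sit at one point, so the difference of two of their positions depends on
the internal displacement only. -/
theorem slice_latticePotential {w : (Fin d → ℤ) → ℝ} (hw : ∃ M : ℝ, ∀ x, ‖(w x : ℂ)‖ ≤ M)
    (b : {b : Others (Fin N) × Fin d → ℤ // rel c b = 0}) (i j : {i : Fin N // i ∈ c})
    (F : LatticeL2 (Others (Fin N) × Fin d)) :
    slice c b (latticePotential w i.1 j.1 F) = latticePotential w i j (slice c b F) := by
  obtain ⟨M, hM⟩ := hw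
  refine lp.ext (funext fun y => ?_)
  rw [slice_apply, latticePotential, latticePotential, latticeMul_apply ⟨M, fun x => hM _⟩,
    latticeMul_apply ⟨M, fun x => hM _⟩, slice_apply]
  have h : ∀ l : {i : Fin N // i ∈ c}, position b.1 l.1 = position b.1 (leader c) := fun l => by
    have := position_rel c b.1 l
    rw [b.2, position_zero] at this
    exact (sub_eq_zero.1 this.symm)
  rw [position_add, position_add, h i, h j, add_sub_add_left_eq_sub,
    position_embed_of_mem c y i.2, position_embed_of_mem c y j.2]

/-- On every slice, the frozen part acts as the Hamiltonian of the cluster. -/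
theorem slice_frozenPart (he : ∀ i, Summable fun s => ‖e i s‖)
    (hv : ∀ i j, i < j → ∃ M : ℝ, ∀ x, ‖(v i j x : ℂ)‖ ≤ M) (k : UnitAddTorus (Fin d))
    (b : {b : Others (Fin N) × Fin d → ℤ // rel c b = 0})
    (F : LatticeL2 (Others (Fin N) × Fin d)) :
    slice c b (frozenPart c e v k F)
      = latticeHamiltonian (ι := {i : Fin N // i ∈ c}) (fun i => e i) (fun i j => v i j) k
        (slice c b F) := by
  rw [frozenPart, latticeHamiltonian, sub_apply, sub_apply, map_sub, sum_apply, sum_apply,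
    sum_apply, sum_apply, map_sum, map_sum]
  congr 1
  · refine Finset.sum_congr rfl fun j _ => ?_
    have h1 := (tsum_smul_shift_apply (he j) (norm_phase k j) (fun s => embed c (hop j s)) F).mapL
      (slice c b)
    have h2 := tsum_smul_shift_apply (he j) (norm_phase k j) (hop j) (slice c b F)
    refine (h1.congr_fun fun s => ?_).unique h2
    rw [map_smul, slice_shift_embed]
  · refine Finset.sum_congr rfl fun ij hij => ?_
    exact slice_latticePotential c (hv _ _ (Finset.mem_filter.1 hij).2) b ij.1 ij.2 F

/-- Near quasi-momentum `k` of the cluster, the part of the Hamiltonian of the cluster is close to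
the frozen part. -/
theorem tendsto_clusterPart_sub_frozenPart (he : ∀ i, Summable fun s => ‖e i s‖)
    (K k : UnitAddTorus (Fin d)) {ν : Type} {l : Filter ν}
    {f : ν → LatticeL2 (Others (Fin N) × Fin d)} (hf : ∀ n, ‖f n‖ = 1)
    (h : ∀ s, ApproxEigen l f (clusterShift c K s) (UnitAddTorus.mFourier s k)) :
    ApproxEigen l f (clusterPart c e v K - frozenPart c e v k) 0 := by
  -- Potentials cancel, and a particle other than the leader hops in the same way, with phase 1, in
  -- both operators. Only the leader term remains.
  have h1 : clusterPart c e v K - frozenPart c e v k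
      = latticeKinetic (e (leader c)) K (leader c)
        - ∑' s, (e (leader c) s * UnitAddTorus.mFourier s k) •
          shift (embed c (hop (lastParticle {i : Fin N // i ∈ c}) s)) := by
    rw [clusterPart, frozenPart, sub_sub_sub_cancel_right, ← Finset.sum_sub_distrib,
      Finset.sum_eq_single (lastParticle {i : Fin N // i ∈ c})]
    · simp [phase, leader]
    · intro j _ hj
      have h2 : j.1 ≠ lastParticle (Fin N) := fun h => hj (coe_eq_last_iff.1 h).1
      simp only [latticeKinetic, phase, if_neg hj, if_neg h2, embed_hop_of_ne c hj, sub_self]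
    · simp
  have h2 : ∀ n, (clusterPart c e v K - frozenPart c e v k) (f n) - (0 : ℂ) • f n
      = ∑' s, e (leader c) s • shift (embed c (hop (lastParticle {i : Fin N // i ∈ c}) s))
        (clusterShift c K s (f n) - UnitAddTorus.mFourier s k • f n) := fun n => by
    rw [zero_smul, sub_zero, h1, sub_apply]
    refine (((tsum_smul_shift_apply (he _) (norm_phase K (leader c)) (hop (leader c)) (f n)).sub
      (tsum_smul_shift_apply (he _) (fun s => norm_mFourier_apply s k)
        (fun s => embed c (hop (lastParticle {i : Fin N // i ∈ c}) s)) (f n))).tsum_eq.symm.trans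
      (tsum_congr fun s => ?_))
    rw [hop_leader, add_comm, ← shift_mul_shift, map_sub, map_smul, smul_sub, phase_leader,
      clusterShift, smul_apply, map_smul, smul_smul, smul_smul]
    rfl
  refine Tendsto.congr (fun n => (h2 n).symm) ?_
  rw [show (0 : LatticeL2 (Others (Fin N) × Fin d)) = ∑' _ : Fin d → ℤ, 0 from tsum_zero.symm]
  -- Each summand tends to zero by hypothesis; as translations are isometric and f n is a unit
  -- vector, 2|e(s)| is a summable bound.
  refine tendsto_tsum_of_dominated_convergence (bound := fun s => ‖e (leader c) s‖ * 2)
    ((he _).mul_right 2) (fun s => ?_) (.of_forall fun n s => ?_)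
  · have := (((shift (embed c (hop (lastParticle {i : Fin N // i ∈ c}) s))).continuous.tendsto
      0).comp (h s)).const_smul (e (leader c) s)
    rwa [map_zero, smul_zero] at this
  · rw [norm_smul, norm_shift_apply]
    gcongr
    refine (norm_sub_le _ _).trans ?_
    rw [norm_clusterShift_apply, norm_smul, norm_mFourier_apply, hf]
    norm_num

/-! ### Commutation relations -/

theorem shift_commute_shift {G : Type} [AddCommGroup G] (g h : G) : Commute (shift g) (shift h) := by
  rw [Commute, SemiconjBy, shift_mul_shift, shift_mul_shift, add_comm]

theorem shift_commute_latticeKinetic (e : (Fin d → ℤ) → ℂ) (K : UnitAddTorus (Fin d)) (i : Fin N)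
    (g : Others (Fin N) × Fin d → ℤ) : Commute (shift g) (latticeKinetic e K i) :=
  Commute.tsum_right _ fun _ => (shift_commute_shift _ _).smul_right _

theorem latticeKinetic_commute (e e' : (Fin d → ℤ) → ℂ) (K : UnitAddTorus (Fin d)) (i j : Fin N) :
    Commute (latticeKinetic e K i) (latticeKinetic e' K j) :=
  Commute.tsum_left _ fun _ => (shift_commute_latticeKinetic _ _ _ _).smul_left _

theorem shift_commute_latticePotential {w : (Fin d → ℤ) → ℝ}
    (hw : ∃ M : ℝ, ∀ x, ‖(w x : ℂ)‖ ≤ M) {i j : Fin N} {g : Others (Fin N) × Fin d → ℤ}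
    (h : position g i = position g j) : Commute (shift g) (latticePotential w i j) := by
  obtain ⟨M, hM⟩ := hw
  refine shift_commute_latticeMul ⟨M, fun x => hM _⟩ fun x => ?_
  rw [position_sub, position_sub, h, sub_sub_sub_cancel_right]

theorem latticePotential_commute {w w' : (Fin d → ℤ) → ℝ}
    (hw : ∃ M : ℝ, ∀ x, ‖(w x : ℂ)‖ ≤ M) (hw' : ∃ M : ℝ, ∀ x, ‖(w' x : ℂ)‖ ≤ M)
    (i j i' j' : Fin N) :
    Commute (latticePotential (d := d) w i j) (latticePotential w' i' j') := by
  obtain ⟨M, hM⟩ := hw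
  obtain ⟨M', hM'⟩ := hw'
  exact latticeMul_commute ⟨M, fun x => hM _⟩ ⟨M', fun x => hM' _⟩

/-- A hop of a third particle l displaces i and j equally: by 0, or by -s if l is the last particle.
-/
theorem latticeKinetic_commute_latticePotential (e : (Fin d → ℤ) → ℂ) (K : UnitAddTorus (Fin d))
    {w : (Fin d → ℤ) → ℝ} (hw : ∃ M : ℝ, ∀ x, ‖(w x : ℂ)‖ ≤ M) {i j l : Fin N}
    (hi : i ≠ l) (hj : j ≠ l) :
    Commute (latticeKinetic e K l) (latticePotential w i j) :=
  Commute.tsum_left _ fun s => (shift_commute_latticePotential hw (by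
    rw [position_hop, position_hop, if_neg hi, if_neg hj])).smul_left _

theorem clusterShift_commute_clusterShift (c c' : Finset (Fin N)) (K : UnitAddTorus (Fin d))
    (s s' : Fin d → ℤ) : Commute (clusterShift c K s) (clusterShift c' K s') :=
  ((shift_commute_shift _ _).smul_left _).smul_right _

/-- A cluster translation displaces all particles of c by the same vector, even if it moves the
origin, so it preserves the differences x_i - x_j inside c. -/
theorem clusterShift_commute_clusterPart
    (hv : ∀ i j, i < j → ∃ M : ℝ, ∀ x, ‖(v i j x : ℂ)‖ ≤ M) {c' : Finset (Fin N)}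
    (hc : c' = c ∨ Disjoint c c') (K : UnitAddTorus (Fin d)) (s : Fin d → ℤ) :
    Commute (clusterShift c' K s) (clusterPart c e v K) := by
  refine Commute.smul_left (Commute.sub_right (Commute.sum_right _ _ _ fun j _ =>
    shift_commute_latticeKinetic _ _ _ _) (Commute.sum_right _ _ _ fun ij hij =>
      shift_commute_latticePotential (hv _ _ (Finset.mem_filter.1 hij).2) ?_)) _
  rw [position_clusterHop, position_clusterHop]
  rcases hc with rfl | hc
  · rw [if_pos ij.1.2, if_pos ij.2.2]
  · rw [if_neg (Finset.disjoint_left.1 hc ij.1.2), if_neg (Finset.disjoint_left.1 hc ij.2.2)]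

theorem clusterPart_commute_clusterPart
    (hv : ∀ i j, i < j → ∃ M : ℝ, ∀ x, ‖(v i j x : ℂ)‖ ≤ M) {c' : Finset (Fin N)}
    [Nonempty {i : Fin N // i ∈ c'}] (hc : Disjoint c c') (K : UnitAddTorus (Fin d)) :
    Commute (clusterPart c e v K) (clusterPart c' e v K) := by
  have hne : ∀ (i : {i : Fin N // i ∈ c}) (j : {i : Fin N // i ∈ c'}), i.1 ≠ j.1 := fun i j h =>
    Finset.disjoint_left.1 hc i.2 (h ▸ j.2)
  refine Commute.sub_left (Commute.sub_right ?_ ?_) (Commute.sub_right ?_ ?_)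
  · exact Commute.sum_left _ _ _ fun i _ => Commute.sum_right _ _ _ fun j _ =>
      latticeKinetic_commute _ _ _ _ _
  · exact Commute.sum_left _ _ _ fun i _ => Commute.sum_right _ _ _ fun jl hjl =>
      latticeKinetic_commute_latticePotential _ _ (hv _ _ (Finset.mem_filter.1 hjl).2)
        (hne _ _).symm (hne _ _).symm
  · exact Commute.sum_left _ _ _ fun jl hjl => Commute.sum_right _ _ _ fun i _ =>
      (latticeKinetic_commute_latticePotential _ _ (hv _ _ (Finset.mem_filter.1 hjl).2)
        (hne _ _) (hne _ _)).symm
  · exact Commute.sum_left _ _ _ fun ij hij => Commute.sum_right _ _ _ fun jl hjl =>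
      latticePotential_commute (hv _ _ (Finset.mem_filter.1 hij).2)
        (hv _ _ (Finset.mem_filter.1 hjl).2) _ _ _ _

/-! ### Adjoints -/

theorem star_phase {ι : Type} [Fintype ι] [LinearOrder ι] [Nonempty ι]
    (k : UnitAddTorus (Fin d)) (i : ι) (s : Fin d → ℤ) : star (phase k i s) = phase k i (-s) := by
  unfold phase
  split_ifs
  · exact UnitAddTorus.mFourier_neg.symm
  · exact star_one _

/-- The adjoint of the summand with index s is the summand with index -s, by the conjugation
symmetry of e. -/
theorem isSelfAdjoint_latticeKinetic {ι : Type} [Fintype ι] [LinearOrder ι] [Nonempty ι]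
    {e : (Fin d → ℤ) → ℂ} (he : ∀ y, e y = conj (e (-y))) (k : UnitAddTorus (Fin d)) (i : ι) :
    IsSelfAdjoint (latticeKinetic e k i) := by
  rw [IsSelfAdjoint, latticeKinetic, tsum_star, ← (Equiv.neg _).tsum_eq]
  refine tsum_congr fun s => ?_
  rw [star_smul, star_shift, Equiv.neg_apply, map_neg, neg_neg, star_mul', star_phase, neg_neg,
    he s]
  rfl

theorem isSelfAdjoint_latticePotential {ι : Type} [Fintype ι] [LinearOrder ι] [Nonempty ι]
    {w : (Fin d → ℤ) → ℝ} (hw : ∃ M : ℝ, ∀ x, ‖(w x : ℂ)‖ ≤ M) (i j : ι) :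
    IsSelfAdjoint (latticePotential w i j) := by
  obtain ⟨M, hM⟩ := hw
  exact isSelfAdjoint_latticeMul ⟨M, fun x => hM _⟩

theorem isSelfAdjoint_latticeHamiltonian {ι : Type} [Fintype ι] [LinearOrder ι] [Nonempty ι]
    {e : ι → (Fin d → ℤ) → ℂ} {v : ι → ι → (Fin d → ℤ) → ℝ}
    (he : ∀ i y, e i y = conj (e i (-y)))
    (hv : ∀ i j, i < j → ∃ M : ℝ, ∀ x, ‖(v i j x : ℂ)‖ ≤ M) (k : UnitAddTorus (Fin d)) :
    IsSelfAdjoint (latticeHamiltonian e v k) :=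
  (isSelfAdjoint_sum _ fun i _ => isSelfAdjoint_latticeKinetic (he i) k i).sub
    (isSelfAdjoint_sum _ fun _ hij =>
      isSelfAdjoint_latticePotential (hv _ _ (Finset.mem_filter.1 hij).2) _ _)

theorem isSelfAdjoint_clusterPart (he : ∀ i y, e i y = conj (e i (-y)))
    (hv : ∀ i j, i < j → ∃ M : ℝ, ∀ x, ‖(v i j x : ℂ)‖ ≤ M) (K : UnitAddTorus (Fin d)) :
    IsSelfAdjoint (clusterPart c e v K) := by
  unfold clusterPart
  exact IsSelfAdjoint.sub (isSelfAdjoint_sum _ fun j _ =>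
    isSelfAdjoint_latticeKinetic (he j) K j.1) (isSelfAdjoint_sum _ fun _ hij =>
      isSelfAdjoint_latticePotential (hv _ _ (Finset.mem_filter.1 hij).2) _ _)

theorem clusterHop_neg (c : Finset (Fin N)) (s : Fin d → ℤ) :
    clusterHop c (-s) = -clusterHop c s := by
  simp [clusterHop]

theorem clusterHop_add (c : Finset (Fin N)) (s t : Fin d → ℤ) :
    clusterHop c (s + t) = clusterHop c s + clusterHop c t := by
  simp [clusterHop, Finset.sum_add_distrib]

theorem star_clusterShift (K : UnitAddTorus (Fin d)) (s : Fin d → ℤ) :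
    star (clusterShift c K s) = clusterShift c K (-s) := by
  rw [clusterShift, clusterShift, star_smul, star_shift, clusterHop_neg, ← phase_leader,
    ← phase_leader, star_phase]

theorem clusterShift_mul (K : UnitAddTorus (Fin d)) (s t : Fin d → ℤ) :
    clusterShift c K s * clusterShift c K t = clusterShift c K (s + t) := by
  rw [clusterShift, clusterShift, clusterShift, smul_mul_smul_comm, shift_mul_shift,
    clusterHop_add]
  congr 1
  unfold clusterPhase
  split_ifs
  · exact UnitAddTorus.mFourier_add.symm
  · exact one_mul 1

end ClusterParts

/-! ### Decomposition of the cluster operator -/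

section Decomposition

variable {N : ℕ} (C : Finpartition (Finset.univ : Finset (Fin N)))

theorem disjoint_clusters {c c' : {s : Finset (Fin N) // s ∈ C.parts}} (h : c ≠ c') :
    Disjoint c.1 c'.1 :=
  C.disjoint c.2 c'.2 fun h' => h (Subtype.ext h')

theorem sum_clusters {M : Type} [AddCommMonoid M] (g : Fin N → M) :
    ∑ c : {s : Finset (Fin N) // s ∈ C.parts}, ∑ j : {i : Fin N // i ∈ c.1}, g j = ∑ i, g i := by
  have h1 : ∀ c : {s : Finset (Fin N) // s ∈ C.parts},
      ∑ j : {i : Fin N // i ∈ c.1}, g j = ∑ j ∈ c.1, g j := fun c => Finset.sum_coe_sort c.1 g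
  rw [Finset.sum_congr rfl fun c _ => h1 c, Finset.sum_coe_sort C.parts fun c => ∑ j ∈ c, g j,
    show ∑ i, g i = ∑ i ∈ C.parts.biUnion id, g i by rw [C.biUnion_parts],
    Finset.sum_biUnion C.disjoint]
  rfl

theorem sum_cluster_pairs {M : Type} [AddCommMonoid M] (g : Fin N → Fin N → M) :
    ∑ c : {s : Finset (Fin N) // s ∈ C.parts},
        ∑ ij : {i : Fin N // i ∈ c.1} × {i : Fin N // i ∈ c.1} with ij.1 < ij.2, g ij.1 ij.2
      = ∑ ij : Fin N × Fin N with ij.1 < ij.2 ∧ ∃ s ∈ C.parts, ij.1 ∈ s ∧ ij.2 ∈ s,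
        g ij.1 ij.2 := by
  classical
  have h1 : ∀ (c : {s : Finset (Fin N) // s ∈ C.parts}) (i : {i : Fin N // i ∈ c.1}),
      ∑ j : {i : Fin N // i ∈ c.1}, (if i < j then g i j else 0)
        = ∑ j, if i.1 < j ∧ ∃ s ∈ C.parts, i.1 ∈ s ∧ j ∈ s then g i j else 0 := fun c i => by
    have h2 := Finset.sum_coe_sort c.1 fun j => if i.1 < j then g i j else 0
    refine h2.trans ?_
    rw [← Finset.sum_subset (Finset.subset_univ c.1)]
    · refine Finset.sum_congr rfl fun j hj => ?_
      have : ∃ s ∈ C.parts, i.1 ∈ s ∧ j ∈ s := ⟨c.1, c.2, i.2, hj⟩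
      simp [this]
    · intro j _ hj
      refine if_neg fun ⟨_, s, hs, his, hjs⟩ => hj ?_
      rwa [C.disjoint.elim_finset c.2 hs i.1 i.2 his]
  rw [Finset.sum_filter, Fintype.sum_prod_type, ← sum_clusters C]
  refine Finset.sum_congr rfl fun c _ => ?_
  rw [Finset.sum_filter, Fintype.sum_prod_type]
  exact Finset.sum_congr rfl fun i _ => h1 c i

variable {d : ℕ} [NeZero N]

/-- Adding `interCluster` removes exactly the pair potentials that link different clusters; what
remains is grouped by cluster. -/
theorem fourierConj_clusterOperator {e : Fin N → (Fin d → ℤ) → ℂ}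
    (he : ∀ i, Summable fun s => ‖e i s‖) (v : Fin N → Fin N → (Fin d → ℤ) → ℝ)
    (K : UnitAddTorus (Fin d)) :
    fourierConj (Fin N) d (clusterOperator e v C K)
      = ∑ c : {s : Finset (Fin N) // s ∈ C.parts}, clusterPart c.1 e v K := by
  classical
  have h1 := Finset.sum_filter_add_sum_filter_not
    (Finset.univ.filter fun ij : Fin N × Fin N => ij.1 < ij.2)
    (fun ij : Fin N × Fin N => ∃ s ∈ C.parts, ij.1 ∈ s ∧ ij.2 ∈ s)
    (fun ij => latticePotential (d := d) (v ij.1 ij.2) ij.1 ij.2)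
  rw [Finset.filter_filter, Finset.filter_filter] at h1
  rw [clusterOperator, map_add, hamiltonian_eq, fourierConj_fiberConj_fiberHamiltonian he,
    interCluster, map_sum, latticeHamiltonian]
  simp only [fourierConj_potential, clusterPart]
  rw [Finset.sum_sub_distrib, sum_clusters C fun i => latticeKinetic (e i) K i,
    sum_cluster_pairs C fun i j => latticePotential (v i j) i j, ← h1]
  rw [sub_add_eq_sub_sub]
  convert! sub_add_cancel _ _ using 3

end Decomposition

/-! ### Characters of the lattice -/

/-- The values of u at the unit vectors lie on the circle and give the coordinates of k; a
homomorphism on ℤ^d is determined by these values. -/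
theorem exists_eq_mFourier {d : ℕ} {u : (Fin d → ℤ) → ℂ} (hmul : ∀ s t, u (s + t) = u s * u t)
    (hnorm : ∀ s, ‖u s‖ = 1) : ∃ k : UnitAddTorus (Fin d), ∀ s, u s = UnitAddTorus.mFourier s k := by
  have h0 : u 0 = 1 := by
    have h1 := hmul 0 0
    rw [add_zero] at h1
    have h2 : u 0 ≠ 0 := fun h => by simpa [h] using hnorm 0
    exact (mul_eq_left₀ h2).1 h1.symm
  choose k hk using fun a => (AddCircle.homeomorphCircle (T := 1) one_ne_zero).surjective
    (⟨u (Pi.single a 1), mem_sphere_zero_iff_norm.2 (hnorm _)⟩ : Circle)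
  refine ⟨k, fun s => ?_⟩
  let f : (Fin d → ℤ) →+ Additive ℂ :=
    { toFun := fun s => Additive.ofMul (u s)
      map_zero' := h0
      map_add' := hmul }
  let g : (Fin d → ℤ) →+ Additive ℂ :=
    { toFun := fun s => Additive.ofMul (UnitAddTorus.mFourier s k)
      map_zero' := by rw [UnitAddTorus.mFourier_zero]; rfl
      map_add' := fun s t => congrArg Additive.ofMul UnitAddTorus.mFourier_add }
  have hfg : f = g := by
    refine AddMonoidHom.functions_ext' _ _ _ fun a => AddMonoidHom.ext_int ?_
    change u (Pi.single a 1) = UnitAddTorus.mFourier (Pi.single a 1) k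
    rw [UnitAddTorus.mFourier_single, fourier_one, ← AddCircle.homeomorphCircle_apply one_ne_zero,
      hk]
  exact DFunLike.congr_fun hfg s

theorem eq_of_mFourier_eq {d : ℕ} {k k' : UnitAddTorus (Fin d)}
    (h : ∀ s, UnitAddTorus.mFourier s k = UnitAddTorus.mFourier s k') : k = k' := by
  ext a
  have := h (Pi.single a 1)
  rw [UnitAddTorus.mFourier_single, UnitAddTorus.mFourier_single, fourier_one, fourier_one] at this
  exact AddCircle.injective_toCircle one_ne_zero (Circle.coe_injective this)

/-! ### Every spectral value is a sum of spectral values of the clusters -/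

/-- The norm of the resolvent serves as M. It does not depend on φ, so one constant works on all
slices. -/
theorem exists_norm_le_of_notMem_spectrum {E : Type} [NormedAddCommGroup E] [InnerProductSpace ℂ E]
    {A : E →L[ℂ] E} {z : ℂ} (hz : z ∉ spectrum ℂ A) :
    ∃ M : ℝ, 0 ≤ M ∧ ∀ φ, ‖φ‖ ≤ M * ‖A φ - z • φ‖ := by
  rw [spectrum.notMem_iff] at hz
  obtain ⟨u, hu⟩ := hz
  refine ⟨‖(↑u⁻¹ : E →L[ℂ] E)‖, norm_nonneg _, fun φ => ?_⟩
  have h1 : A φ - z • φ = -(u : E →L[ℂ] E) φ := by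
    rw [hu]
    simp [Algebra.algebraMap_eq_smul_one]
  have h2 : (↑u⁻¹ : E →L[ℂ] E) ((u : E →L[ℂ] E) φ) = φ := by
    rw [← mul_apply_eq_comp, Units.inv_mul]
    rfl
  rw [h1, norm_neg]
  nth_rewrite 1 [← h2]
  exact ContinuousLinearMap.le_opNorm _ _

section SpectralInclusion

variable {N d : ℕ} [NeZero N] {e : Fin N → (Fin d → ℤ) → ℂ}
  {v : Fin N → Fin N → (Fin d → ℤ) → ℝ} (C : Finpartition (Finset.univ : Finset (Fin N)))

theorem sum_hop_eq_zero (s : Fin d → ℤ) : ∑ i : Fin N, hop i s = 0 := by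
  refine ext_position fun j => ?_
  have := position_clusterHop (Finset.univ : Finset (Fin N)) s j
  rw [clusterHop] at this
  rw [this, position_zero]
  simp

theorem sum_clusterHop (s : Fin d → ℤ) :
    ∑ c : {s : Finset (Fin N) // s ∈ C.parts}, clusterHop c.1 s = 0 := by
  rw [← sum_hop_eq_zero (N := N) s, ← sum_clusters C]
  exact Finset.sum_congr rfl fun c _ => (Finset.sum_coe_sort c.1 fun i => hop i s).symm

/-- Exactly one cluster contains the last particle. Together with `sum_clusterHop` this shows that
translating all clusters by s is multiplication by e^{i(s,K)}. -/
theorem prod_clusterPhase (K : UnitAddTorus (Fin d)) (s : Fin d → ℤ) :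
    ∏ c : {s : Finset (Fin N) // s ∈ C.parts}, clusterPhase c.1 K s
      = UnitAddTorus.mFourier s K := by
  obtain ⟨c, hc, hlast⟩ := C.exists_mem (Finset.mem_univ (lastParticle (Fin N)))
  rw [Finset.prod_eq_single (⟨c, hc⟩ : {s : Finset (Fin N) // s ∈ C.parts})]
  · simp [clusterPhase, hlast]
  · intro c' _ hne
    refine if_neg fun h => hne (Subtype.ext ?_)
    exact C.disjoint.elim_finset c'.2 hc _ h hlast
  · simp

theorem mem_sum_spectrum_of_mem_spectrum (he : ∀ i, Summable fun s => ‖e i s‖)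
    (he_sa : ∀ i y, e i y = conj (e i (-y)))
    (hv : ∀ i j, i < j → ∃ M : ℝ, ∀ x, ‖(v i j x : ℂ)‖ ≤ M) (K : UnitAddTorus (Fin d)) {z : ℂ}
    (hz : z ∈ spectrum ℂ (∑ c : {s : Finset (Fin N) // s ∈ C.parts}, clusterPart c.1 e v K)) :
    ∃ (k : {s : Finset (Fin N) // s ∈ C.parts} → UnitAddTorus (Fin d))
      (w : {s : Finset (Fin N) // s ∈ C.parts} → ℂ), ∑ c, k c = K ∧ ∑ c, w c = z ∧
      ∀ c : {s : Finset (Fin N) // s ∈ C.parts}, w c ∈ spectrum ℂ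
        (latticeHamiltonian (ι := {i : Fin N // i ∈ c.1}) (fun i => e i) (fun i j => v i j)
          (k c)) := by
  let H : {s : Finset (Fin N) // s ∈ C.parts} →
    (LatticeL2 (Others (Fin N) × Fin d) →L[ℂ] LatticeL2 (Others (Fin N) × Fin d)) :=
    fun c => clusterPart c.1 e v K
  let S := Set.range H ∪
    Set.range fun cs : {s : Finset (Fin N) // s ∈ C.parts} × (Fin d → ℤ) =>
      clusterShift cs.1.1 K cs.2
  have hUH : ∀ (c c' : {s : Finset (Fin N) // s ∈ C.parts}) (s : Fin d → ℤ),
      Commute (clusterShift c'.1 K s) (H c) := fun c c' s => by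
    refine clusterShift_commute_clusterPart c.1 hv ?_ K s
    rcases eq_or_ne c c' with rfl | h
    · exact Or.inl rfl
    · exact Or.inr (disjoint_clusters C h)
  have hcomm : ∀ a ∈ S, ∀ b ∈ S, Commute a b := by
    rintro _ (⟨c, rfl⟩ | ⟨cs, rfl⟩) _ (⟨c', rfl⟩ | ⟨cs', rfl⟩)
    · rcases eq_or_ne c c' with rfl | h
      · exact Commute.refl _
      · exact clusterPart_commute_clusterPart c.1 hv (disjoint_clusters C h) K
    · exact (hUH _ _ _).symm
    · exact hUH _ _ _
    · exact clusterShift_commute_clusterShift _ _ _ _ _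
  have hstar : ∀ a ∈ S, star a ∈ S := by
    rintro _ (⟨c, rfl⟩ | ⟨cs, rfl⟩)
    · exact Or.inl ⟨c, (isSelfAdjoint_clusterPart c.1 he_sa hv K).star_eq.symm⟩
    · exact Or.inr ⟨(cs.1, -cs.2), (star_clusterShift cs.1.1 K cs.2).symm⟩
  obtain ⟨ν, l, f, hl, hf, hfz, hfS⟩ := exists_joint_approxEigen hcomm hstar
    (sum_mem fun c _ => StarAlgebra.subset_adjoin ℂ S (Or.inl ⟨c, rfl⟩)) hz
  choose w hw using fun c => hfS (H c) (Or.inl ⟨c, rfl⟩)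
  choose u hu using fun c s => hfS (clusterShift c.1 K s) (Or.inr ⟨(c, s), rfl⟩)
  -- Limit eigenvalues on unit vectors are unique, hence multiplicative in s, and unimodular because
  -- the translations are isometric.
  choose k hk using fun c => exists_eq_mFourier (u := u c)
    (fun s t => (hu c (s + t)).eq hf (clusterShift_mul c.1 K s t ▸ (hu c s).mul (hu c t)))
    (fun s => (hu c s).norm_eq_one hf (norm_clusterShift_apply c.1 K s))
  refine ⟨k, w, ?_, (ApproxEigen.sum fun c _ => hw c).eq hf hfz, fun c => ?_⟩
  · refine eq_of_mFourier_eq fun s => ?_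
    have h1 : ∀ t : Finset {s : Finset (Fin N) // s ∈ C.parts}, ApproxEigen l f
        ((∏ c ∈ t, clusterPhase c.1 K s) • shift (∑ c ∈ t, clusterHop c.1 s))
        (∏ c ∈ t, u c s) := fun t => by
      classical
      induction t using Finset.induction_on with
      | empty => simpa [shift_zero] using ApproxEigen.one
      | insert c t hc ih =>
        rw [Finset.prod_insert hc, Finset.prod_insert hc, Finset.sum_insert hc,
          ← shift_mul_shift, ← smul_mul_smul_comm]
        exact (hu c s).mul ih
    have h2 := h1 Finset.univ
    rw [sum_clusterHop, prod_clusterPhase, shift_zero] at h2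
    have h3 : ApproxEigen l f (UnitAddTorus.mFourier s K • 1) (UnitAddTorus.mFourier s K) :=
      tendsto_const_nhds.congr fun n => by simp
    rw [mFourier_apply_sum, ← h3.eq hf h2 |>.symm]
    exact (Finset.prod_congr rfl fun c _ => hk c s).symm
  · by_contra hc
    obtain ⟨M, hM, hM2⟩ := exists_norm_le_of_notMem_spectrum hc
    have h1 := tendsto_clusterPart_sub_frozenPart c.1 (v := v) he K (k c) hf
      fun s => hk c s ▸ hu c s
    have h2 : ApproxEigen l f (frozenPart c.1 e v (k c)) (w c) := by
      have := (hw c).sub h1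
      rw [sub_zero] at this
      refine this.congr fun n => ?_
      simp only [H, sub_apply, zero_smul, sub_zero]
      abel
    -- With M + 1 in place of M the constant is defined even for M = 0, and the approximate
    -- eigenvector contradicts the bound with M.
    obtain ⟨F, hF0, hF⟩ := h2.exists_lt hf (show (0 : ℝ) < (M + 1)⁻¹ by positivity)
    have h3 : ‖F‖ ≤ M * ‖frozenPart c.1 e v (k c) F - w c • F‖ := by
      refine norm_le_of_slice_le c.1 hM fun b => ?_
      rw [map_sub, map_smul, slice_frozenPart c.1 he hv]
      exact hM2 _
    have h4 : 0 < ‖F‖ := norm_pos_iff.2 hF0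
    have h5 : (M + 1) * ‖frozenPart c.1 e v (k c) F - w c • F‖ < ‖F‖ := by
      rwa [inv_mul_eq_div, lt_div_iff₀' (by positivity)] at hF
    nlinarith [norm_nonneg (frozenPart c.1 e v (k c) F - w c • F)]

end SpectralInclusion

/-! ### Trial vectors -/

section TrialVectors

/-- As m and n differ by at most p, the ratio of the powers lies between r^p and r^{-p}. The upper
deviation is the larger one because r^p + r^{-p} ≥ 2. -/
theorem abs_pow_sub_pow_le {r : ℝ} (h0 : 0 < r) (h1 : r ≤ 1) {m n p : ℕ} (hmn : m ≤ n + p)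
    (hnm : n ≤ m + p) : |r ^ m - r ^ n| ≤ (r⁻¹ ^ p - 1) * r ^ n := by
  have hq : 0 < r ^ p := pow_pos h0 p
  have hn : 0 < r ^ n := pow_pos h0 n
  have hm1 : r ^ m * r ^ p ≤ r ^ n := by
    rw [← pow_add]
    exact pow_le_pow_of_le_one h0.le h1 hnm
  have hm2 : r ^ n * r ^ p ≤ r ^ m := by
    rw [← pow_add]
    exact pow_le_pow_of_le_one h0.le h1 hmn
  have hinv : r ^ p * r⁻¹ ^ p = 1 := by rw [← mul_pow, mul_inv_cancel₀ h0.ne', one_pow]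
  have hi : 0 < r⁻¹ ^ p := by positivity
  rw [abs_le]
  constructor
  · have h2 : 2 ≤ r ^ p + r⁻¹ ^ p := by nlinarith [sq_nonneg (r ^ p - r⁻¹ ^ p)]
    nlinarith
  · have : r ^ m * r ^ p * r⁻¹ ^ p ≤ r ^ n * r⁻¹ ^ p := by gcongr
    rw [mul_assoc, hinv, mul_one] at this
    linarith

theorem summable_norm_sq_mul {α β : Type} (φ : SqSum α) {g : β → ℝ} (hg : Summable g)
    (h0 : ∀ y, 0 ≤ g y) : Summable fun z : α × β => ‖φ z.1‖ ^ 2 * g z.2 :=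
  Summable.mul_of_nonneg (f := fun x => ‖φ x‖ ^ 2) (summable_norm_sq φ) hg
    (fun x => sq_nonneg ‖φ x‖) h0

theorem summable_norm_sq_mul_exp {d : ℕ} {α : Type} {r : ℝ} (h0 : 0 ≤ r) (h1 : r < 1)
    (φ : SqSum α) : Summable fun z : α × (Fin d → ℤ) => ‖φ z.1‖ ^ 2 * ∏ a, r ^ (z.2 a).natAbs :=
  have hg : Summable fun u : Fin d → ℤ => ∏ a, r ^ (u a).natAbs :=
    summable_prod_pi (α := fun _ => ℤ) (f := fun _ n => r ^ n.natAbs)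
      (fun _ _ => pow_nonneg h0 _) fun _ => summable_pow_natAbs h0 h1
  summable_norm_sq_mul φ (g := fun u : Fin d → ℤ => ∏ a, r ^ (u a).natAbs) hg
    fun u => Finset.prod_nonneg fun a _ => pow_nonneg h0 (u a).natAbs

variable {N d : ℕ} [NeZero N] (C : Finpartition (Finset.univ : Finset (Fin N)))

/-- The sum of the distances of the clusters from the last particle. -/
def spread (x : Others (Fin N) × Fin d → ℤ) : ℕ :=
  ∑ c : {s : Finset (Fin N) // s ∈ C.parts}, ∑ a, (position x (leader c.1) a).natAbs

theorem spread_add_le (x y : Others (Fin N) × Fin d → ℤ) :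
    spread C (x + y) ≤ spread C x + spread C y := by
  unfold spread
  rw [← Finset.sum_add_distrib]
  refine Finset.sum_le_sum fun c _ => ?_
  rw [← Finset.sum_add_distrib]
  refine Finset.sum_le_sum fun a _ => ?_
  rw [position_add]
  exact Int.natAbs_add_le _ _

/-- The plane wave in the positions of the clusters, with quasi-momenta `-k`. -/
def planeWave (k : {s : Finset (Fin N) // s ∈ C.parts} → UnitAddTorus (Fin d))
    (x : Others (Fin N) × Fin d → ℤ) : ℂ :=
  ∏ c : {s : Finset (Fin N) // s ∈ C.parts}, UnitAddTorus.mFourier (-position x (leader c.1)) (k c)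

theorem norm_planeWave (k : {s : Finset (Fin N) // s ∈ C.parts} → UnitAddTorus (Fin d))
    (x : Others (Fin N) × Fin d → ℤ) : ‖planeWave C k x‖ = 1 := by
  rw [planeWave, norm_prod]
  exact Finset.prod_eq_one fun c _ => norm_mFourier_apply _ _

theorem leader_mem_iff (c c' : {s : Finset (Fin N) // s ∈ C.parts}) :
    leader c'.1 ∈ c.1 ↔ c' = c := by
  refine ⟨fun h => ?_, fun h => h ▸ leader_mem c'.1⟩
  by_contra hne
  exact Finset.disjoint_left.1 (disjoint_clusters C hne) (leader_mem c'.1) h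

/-- If c contains the origin, its translation displaces all leaders by a further -s; the resulting
factor ∏ e^{-i(s,k_c')} = e^{-i(s,K)} is cancelled by `clusterPhase`. This is where ∑ k_c = K is
needed. -/
theorem clusterPhase_mul_planeWave {K : UnitAddTorus (Fin d)}
    {k : {s : Finset (Fin N) // s ∈ C.parts} → UnitAddTorus (Fin d)} (hk : ∑ c, k c = K)
    (c : {s : Finset (Fin N) // s ∈ C.parts}) (s : Fin d → ℤ)
    (x : Others (Fin N) × Fin d → ℤ) :
    clusterPhase c.1 K s * planeWave C k (x - clusterHop c.1 s)
      = UnitAddTorus.mFourier s (k c) * planeWave C k x := by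
  have h1 : ∀ c' : {s : Finset (Fin N) // s ∈ C.parts},
      UnitAddTorus.mFourier (-position (x - clusterHop c.1 s) (leader c'.1)) (k c')
        = UnitAddTorus.mFourier (-position x (leader c'.1)) (k c')
          * (if c' = c then UnitAddTorus.mFourier s (k c') else 1)
          * (if lastParticle (Fin N) ∈ c.1 then UnitAddTorus.mFourier (-s) (k c') else 1) :=
    fun c' => by
    have h2 : -position (x - clusterHop c.1 s) (leader c'.1) = -position x (leader c'.1)
        + (if c' = c then s else 0) + (if lastParticle (Fin N) ∈ c.1 then -s else 0) := by
      rw [position_sub, position_clusterHop]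
      simp only [leader_mem_iff]
      split_ifs <;> simp <;> abel
    rw [h2, UnitAddTorus.mFourier_add, UnitAddTorus.mFourier_add]
    congr 2 <;> split_ifs <;> simp [UnitAddTorus.mFourier_zero]
  have h3 : clusterPhase c.1 K s * (∏ c' : {s : Finset (Fin N) // s ∈ C.parts},
      if lastParticle (Fin N) ∈ c.1 then UnitAddTorus.mFourier (-s) (k c') else 1) = 1 := by
    unfold clusterPhase
    split_ifs
    · rw [← mFourier_apply_sum, hk, ← UnitAddTorus.mFourier_add, add_neg_cancel,
        UnitAddTorus.mFourier_zero]
      rfl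
    · simp
  rw [planeWave, Finset.prod_congr rfl fun c' _ => h1 c', Finset.prod_mul_distrib,
    Finset.prod_mul_distrib, Finset.prod_ite_eq' Finset.univ c, if_pos (Finset.mem_univ _),
    planeWave, mul_left_comm, h3]
  ring

theorem rel_clusterHop (c c' : {s : Finset (Fin N) // s ∈ C.parts}) (s : Fin d → ℤ) :
    rel c'.1 (clusterHop c.1 s) = 0 := by
  refine ext_position fun i => ?_
  rw [position_rel, position_clusterHop, position_clusterHop, position_zero]
  have h : i.1 ∈ c.1 ↔ leader c'.1 ∈ c.1 := by
    rw [leader_mem_iff]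
    refine ⟨fun h => ?_, fun h => h ▸ i.2⟩
    by_contra hne
    exact Finset.disjoint_left.1 (disjoint_clusters C hne) i.2 h
  simp only [h, sub_self]

variable (φ : ∀ c : {s : Finset (Fin N) // s ∈ C.parts},
  LatticeL2 (Others {i : Fin N // i ∈ c.1} × Fin d))

/-- Internal positions and leader positions together determine x, so the family embeds into a
product of families that are summable by square summability of φ c and by geometric series. -/
theorem summable_trial {r : ℝ} (h0 : 0 ≤ r) (h1 : r < 1) :
    Summable fun x : Others (Fin N) × Fin d → ℤ =>
      (∏ c, ‖φ c (rel c.1 x)‖ ^ 2) * r ^ spread C x := by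
  have hf : ∀ c : {s : Finset (Fin N) // s ∈ C.parts}, Summable
      fun z : (Others {i : Fin N // i ∈ c.1} × Fin d → ℤ) × (Fin d → ℤ) =>
        ‖φ c z.1‖ ^ 2 * ∏ a, r ^ (z.2 a).natAbs := fun c =>
    summable_norm_sq_mul_exp h0 h1 (φ c)
  have h2 := summable_prod_pi (fun c z => mul_nonneg (sq_nonneg _)
    (Finset.prod_nonneg fun _ _ => pow_nonneg h0 _)) hf
  have hinj : Function.Injective fun (x : Others (Fin N) × Fin d → ℤ)
      (c : {s : Finset (Fin N) // s ∈ C.parts}) => (rel c.1 x, position x (leader c.1)) := by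
    intro x y hxy
    refine ext_position fun i => ?_
    obtain ⟨c, hi⟩ : ∃ c : {s : Finset (Fin N) // s ∈ C.parts}, i ∈ c.1 := by
      obtain ⟨c, hc, hi⟩ := C.exists_mem (Finset.mem_univ i)
      exact ⟨⟨c, hc⟩, hi⟩
    have h3 := congrFun hxy c
    have h4 := congrArg (fun z => position z ⟨i, hi⟩) (Prod.ext_iff.1 h3).1
    simp only [position_rel] at h4
    have h5 : position x (leader c.1) = position y (leader c.1) := (Prod.ext_iff.1 h3).2
    rwa [h5, sub_left_inj] at h4
  refine (h2.comp_injective hinj).congr fun x => ?_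
  simp only [Function.comp_apply]
  rw [Finset.prod_mul_distrib, spread, ← Finset.prod_pow_eq_pow_sum]
  simp only [Finset.prod_pow_eq_pow_sum]

/-- The product of the vectors `φ c`, the plane wave with quasi-momenta `k` in the positions of the
clusters and a slowly decreasing exponential. -/
def trial (k : {s : Finset (Fin N) // s ∈ C.parts} → UnitAddTorus (Fin d)) {r : ℝ} (h0 : 0 < r)
    (h1 : r < 1) : LatticeL2 (Others (Fin N) × Fin d) :=
  ⟨fun x => (∏ c, φ c (rel c.1 x)) * planeWave C k x * (r ^ spread C x : ℝ), by
    refine memlp_two_iff.2 ((summable_trial C φ (r := r ^ 2) (by positivity)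
      (by nlinarith)).congr fun x => ?_)
    rw [norm_mul, norm_mul, norm_planeWave, mul_one, norm_prod, mul_pow, Complex.norm_real,
      Real.norm_of_nonneg (by positivity), ← Finset.prod_pow, ← pow_mul, ← pow_mul, mul_comm 2]⟩

variable {C} {k : {s : Finset (Fin N) // s ∈ C.parts} → UnitAddTorus (Fin d)}
  {r : ℝ} (h0 : 0 < r) (h1 : r < 1)

theorem trial_apply (x : Others (Fin N) × Fin d → ℤ) : trial C φ k h0 h1 x
    = (∏ c, φ c (rel c.1 x)) * planeWave C k x * (r ^ spread C x : ℝ) := rfl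

/-- Internal positions y_c with φ c (y_c) ≠ 0 can be realised simultaneously by superposing the
embedded displacements, and the other factors never vanish. -/
theorem trial_ne_zero (hφ : ∀ c, φ c ≠ 0) : trial C φ k h0 h1 ≠ 0 := by
  have h2 : ∀ c, ∃ y, φ c y ≠ 0 := fun c => by
    by_contra! h
    exact hφ c (lp.ext (funext h))
  choose y hy using h2
  intro h
  have h3 : ∀ c, rel c.1 (∑ c', embed c'.1 (y c')) = y c := fun c => by
    rw [map_sum, Finset.sum_eq_single c, rel_embed]
    · exact fun c' _ hc' => rel_embed_of_disjoint c.1 (disjoint_clusters C hc'.symm) _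
    · simp
  have h4 := trial_apply (k := k) φ h0 h1 (∑ c', embed c'.1 (y c'))
  rw [h] at h4
  have h5 : planeWave C k (∑ c', embed c'.1 (y c')) ≠ 0 := fun h => by
    have := norm_planeWave C k (∑ c', embed c'.1 (y c'))
    rw [h, norm_zero] at this
    exact zero_ne_one this
  simp only [h3] at h4
  refine mul_ne_zero (mul_ne_zero (Finset.prod_ne_zero_iff.2 fun c _ => hy c) h5) ?_ h4.symm
  exact Complex.ofReal_ne_zero.2 (pow_pos h0 _).ne'

/-- An internal displacement of c changes neither the leader positions nor the internal positions of
other clusters, so every other factor is constant on the slice. -/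
theorem slice_trial (c : {s : Finset (Fin N) // s ∈ C.parts})
    (b : {b : Others (Fin N) × Fin d → ℤ // rel c.1 b = 0}) :
    ∃ a : ℂ, slice c.1 b (trial C φ k h0 h1) = a • φ c := by
  classical
  refine ⟨(∏ c' ∈ Finset.univ.erase c, φ c' (rel c'.1 b.1)) * planeWave C k b.1
    * (r ^ spread C b.1 : ℝ), lp.ext (funext fun y => ?_)⟩
  have h2 : ∀ c' : {s : Finset (Fin N) // s ∈ C.parts},
      position (b.1 + embed c.1 y) (leader c'.1) = position b.1 (leader c'.1) := fun c' => by
    rw [position_add]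
    rcases eq_or_ne c c' with rfl | hne
    · rw [position_embed_leader, add_zero]
    · rw [position_embed_of_notMem, add_zero]
      rw [leader_mem_iff]
      exact hne.symm
  have h3 : ∏ c', φ c' (rel c'.1 (b.1 + embed c.1 y))
      = φ c y * ∏ c' ∈ Finset.univ.erase c, φ c' (rel c'.1 b.1) := by
    rw [← Finset.mul_prod_erase _ _ (Finset.mem_univ c), map_add, b.2, zero_add, rel_embed]
    congr 1
    refine Finset.prod_congr rfl fun c' hc' => ?_
    rw [map_add, rel_embed_of_disjoint c'.1 (disjoint_clusters C (Finset.ne_of_mem_erase hc')),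
      add_zero]
  rw [slice_apply, trial_apply, h3]
  simp only [planeWave, spread, h2]
  change _ = _ * φ c y
  ring

/-- Rigid motions preserve the internal positions and the plane wave transforms exactly; only the
exponential contributes an error, which vanishes as r → 1 with s fixed. -/
theorem norm_clusterShift_trial_sub_le {K : UnitAddTorus (Fin d)} (hk : ∑ c, k c = K)
    (c : {s : Finset (Fin N) // s ∈ C.parts}) (s : Fin d → ℤ) :
    ‖clusterShift c.1 K s (trial C φ k h0 h1)
        - UnitAddTorus.mFourier s (k c) • trial C φ k h0 h1‖
      ≤ (r⁻¹ ^ spread C (clusterHop c.1 s) - 1) * ‖trial C φ k h0 h1‖ := by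
  have hr : 1 ≤ r⁻¹ := (one_le_inv₀ h0).2 h1.le
  refine norm_le_mul_of_pointwise (sub_nonneg.2 (one_le_pow₀ hr)) fun x => ?_
  have h2 : (clusterShift c.1 K s (trial C φ k h0 h1)
        - UnitAddTorus.mFourier s (k c) • trial C φ k h0 h1) x
      = (∏ c, φ c (rel c.1 x)) * UnitAddTorus.mFourier s (k c) * planeWave C k x
        * ((r ^ spread C (x - clusterHop c.1 s) - r ^ spread C x : ℝ) : ℂ) := by
    change clusterPhase c.1 K s * trial C φ k h0 h1 (x - clusterHop c.1 s)
      - UnitAddTorus.mFourier s (k c) * trial C φ k h0 h1 x = _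
    rw [trial_apply, trial_apply, Complex.ofReal_sub]
    have h3 := clusterPhase_mul_planeWave C hk c s x
    simp only [map_sub, rel_clusterHop, sub_zero]
    linear_combination ((∏ c, φ c (rel c.1 x)) * (r ^ spread C (x - clusterHop c.1 s) : ℝ)) * h3
  have h3 : spread C (x - clusterHop c.1 s)
      ≤ spread C x + spread C (clusterHop c.1 s) := by
    have := spread_add_le C x (-clusterHop c.1 s)
    have h4 : spread C (-clusterHop c.1 s) = spread C (clusterHop c.1 s) := by
      unfold spread
      refine Finset.sum_congr rfl fun c' _ => Finset.sum_congr rfl fun a _ => ?_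
      rw [show position (-clusterHop c.1 s) (leader c'.1)
        = -position (clusterHop c.1 s) (leader c'.1) from map_neg (positionHom _) _, Pi.neg_apply,
        Int.natAbs_neg]
    rwa [h4, ← sub_eq_add_neg] at this
  have h4 : spread C x ≤ spread C (x - clusterHop c.1 s) + spread C (clusterHop c.1 s) := by
    simpa using spread_add_le C (x - clusterHop c.1 s) (clusterHop c.1 s)
  rw [h2, trial_apply, norm_mul, norm_mul, norm_mul, norm_mul, norm_mul, norm_planeWave,
    norm_mFourier_apply, mul_one, mul_one, mul_left_comm, Complex.norm_real, Complex.norm_real,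
    Real.norm_eq_abs, Real.norm_of_nonneg (by positivity)]
  exact mul_le_mul_of_nonneg_left (abs_pow_sub_pow_le h0 h1.le h3 h4) (norm_nonneg _)

end TrialVectors

/-! ### Sums of spectral values of the clusters are spectral values -/

section SpectralInclusion

variable {N d : ℕ} [NeZero N] {e : Fin N → (Fin d → ℤ) → ℂ}
  {v : Fin N → Fin N → (Fin d → ℤ) → ℝ} (C : Finpartition (Finset.univ : Finset (Fin N)))

theorem sum_mem_spectrum (he : ∀ i, Summable fun s => ‖e i s‖)
    (he_sa : ∀ i y, e i y = conj (e i (-y)))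
    (hv : ∀ i j, i < j → ∃ M : ℝ, ∀ x, ‖(v i j x : ℂ)‖ ≤ M) {K : UnitAddTorus (Fin d)}
    {k : {s : Finset (Fin N) // s ∈ C.parts} → UnitAddTorus (Fin d)}
    {w : {s : Finset (Fin N) // s ∈ C.parts} → ℂ} (hk : ∑ c, k c = K)
    (hw : ∀ c : {s : Finset (Fin N) // s ∈ C.parts}, w c ∈ spectrum ℂ
      (latticeHamiltonian (ι := {i : Fin N // i ∈ c.1}) (fun i => e i) (fun i j => v i j) (k c))) :
    ∑ c, w c ∈ spectrum ℂ
      (∑ c : {s : Finset (Fin N) // s ∈ C.parts}, clusterPart c.1 e v K) := by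
  have hpos : ∀ n : ℕ, (0 : ℝ) < 1 / ((n : ℝ) + 1) := fun n => by positivity
  choose φ hφ0 hφ using fun (n : ℕ) (c : {s : Finset (Fin N) // s ∈ C.parts}) =>
    exists_norm_sub_lt_of_mem_spectrum
      (isSelfAdjoint_latticeHamiltonian (ι := {i : Fin N // i ∈ c.1}) (e := fun i => e i)
        (v := fun i j => v i j) (fun i => he_sa i) (fun i j hij => hv i j hij) (k c))
      (hw c) (hpos n)
  -- The choice makes r⁻¹ equal to 1 + 1/(n + 1), so the translation error tends to zero along with
  -- the error of the cluster vectors.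
  let r : ℕ → ℝ := fun n => (1 + 1 / ((n : ℝ) + 1))⁻¹
  have hr0 : ∀ n, 0 < r n := fun n => by positivity
  have hr1 : ∀ n, r n < 1 := fun n => inv_lt_one_of_one_lt₀ (by linarith [hpos n])
  let F : ℕ → LatticeL2 (Others (Fin N) × Fin d) := fun n => trial C (φ n) k (hr0 n) (hr1 n)
  have hF : ∀ n, F n ≠ 0 := fun n => trial_ne_zero _ _ _ (hφ0 n)
  let f : ℕ → LatticeL2 (Others (Fin N) × Fin d) := fun n => ((‖F n‖ : ℂ)⁻¹) • F n
  have hf : ∀ n, ‖f n‖ = 1 := fun n => norm_smul_inv_norm (hF n)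
  have hscale : ∀ (A : LatticeL2 (Others (Fin N) × Fin d) →L[ℂ] LatticeL2 (Others (Fin N) × Fin d))
      (z : ℂ) (δ : ℕ → ℝ), (∀ n, ‖A (F n) - z • F n‖ ≤ δ n * ‖F n‖) → Tendsto δ atTop (𝓝 0) →
      ApproxEigen atTop f A z := fun A z δ h hδ => by
    refine squeeze_zero_norm (fun n => ?_) hδ
    have h1 : A (f n) - z • f n = ((‖F n‖ : ℂ)⁻¹) • (A (F n) - z • F n) := by
      simp only [f, map_smul, smul_sub, smul_comm z]
    rw [h1, norm_smul, norm_inv, Complex.norm_real, norm_norm, inv_mul_le_iff₀'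
      (norm_pos_iff.2 (hF n))]
    exact h n
  refine (ApproxEigen.sum fun c _ => ?_).mem_spectrum (l := atTop) hf
  have h1 : ∀ s, ApproxEigen atTop f (clusterShift c.1 K s) (UnitAddTorus.mFourier s (k c)) :=
    fun s => by
    refine hscale _ _ _ (fun n => norm_clusterShift_trial_sub_le (φ n) (hr0 n) (hr1 n) hk c s) ?_
    have h2 : Tendsto (fun n : ℕ => (1 + 1 / ((n : ℝ) + 1)) ^ spread C (clusterHop c.1 s) - 1)
        atTop (𝓝 ((1 + 0) ^ spread C (clusterHop c.1 s) - 1)) :=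
      ((tendsto_one_div_add_atTop_nhds_zero_nat.const_add 1).pow _).sub_const 1
    simpa [r] using h2
  have h2 : ApproxEigen atTop f (frozenPart c.1 e v (k c)) (w c) := by
    refine hscale _ _ _ (fun n => ?_) tendsto_one_div_add_atTop_nhds_zero_nat
    refine norm_le_of_slice_le c.1 (hpos n).le fun b => ?_
    obtain ⟨a, ha⟩ := slice_trial (k := k) (φ n) (hr0 n) (hr1 n) c b
    rw [map_sub, map_smul, slice_frozenPart c.1 he hv, ha, map_smul, smul_comm, ← smul_sub,
      norm_smul, norm_smul, mul_left_comm]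
    exact mul_le_mul_of_nonneg_left (hφ n c) (norm_nonneg a)
  have h3 := h2.add (tendsto_clusterPart_sub_frozenPart c.1 (v := v) he K (k c) hf h1)
  rwa [add_zero, add_sub_cancel] at h3

end SpectralInclusion

/-! ### Absence of eigenvalues of finite multiplicity -/

/-- An eigenspace of A is invariant under W; if it were nonzero and finite dimensional over ℂ, it
would contain an eigenvector of W. -/
theorem not_finiteDimensional_eigenspace {E : Type} [NormedAddCommGroup E] [InnerProductSpace ℂ E]
    {A W : E →L[ℂ] E} (hAW : Commute A W) (hW : ∀ (F : E) (z : ℂ), W F = z • F → F = 0) {z : ℂ}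
    (hz : Module.End.HasEigenvalue (A : E →ₗ[ℂ] E) z) :
    ¬ FiniteDimensional ℂ (Module.End.eigenspace (A : E →ₗ[ℂ] E) z) := by
  intro hfin
  have hnt : Nontrivial (Module.End.eigenspace (A : E →ₗ[ℂ] E) z) :=
    Submodule.nontrivial_iff_ne_bot.2 hz
  have hmaps : ∀ F ∈ Module.End.eigenspace (A : E →ₗ[ℂ] E) z,
      (W : E →ₗ[ℂ] E) F ∈ Module.End.eigenspace (A : E →ₗ[ℂ] E) z := fun F hF => by
    rw [Module.End.mem_eigenspace_iff] at hF ⊢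
    have h1 : A (W F) = W (A F) := DFunLike.congr_fun hAW F
    change A F = z • F at hF
    change A (W F) = z • W F
    rw [h1, hF, map_smul]
  obtain ⟨y, hy⟩ := Module.End.exists_eigenvalue ((W : E →ₗ[ℂ] E).restrict hmaps)
  obtain ⟨F, hF⟩ := hy.exists_hasEigenvector
  refine hF.2 (Subtype.ext (hW F.1 y ?_))
  exact congrArg Subtype.val (Module.End.mem_eigenspace_iff.1 hF.1)

section Essential

variable {N d : ℕ} [NeZero N] {e : Fin N → (Fin d → ℤ) → ℂ}
  {v : Fin N → Fin N → (Fin d → ℤ) → ℝ} (C : Finpartition (Finset.univ : Finset (Fin N)))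

theorem exists_cluster_last_notMem (hC : 2 ≤ C.parts.card) :
    ∃ c : {s : Finset (Fin N) // s ∈ C.parts}, lastParticle (Fin N) ∉ c.1 := by
  obtain ⟨a, ha, b, hb, hab⟩ := Finset.one_lt_card.1 hC
  by_cases h : lastParticle (Fin N) ∈ a
  · exact ⟨⟨b, hb⟩, Finset.disjoint_left.1 (C.disjoint ha hb hab) h⟩
  · exact ⟨⟨a, ha⟩, h⟩

theorem spectrum_clusterOperator_eq_essentialSpectrum (hd : 0 < d)
    (he : ∀ i, Summable fun s => ‖e i s‖)
    (hv : ∀ i j, i < j → ∃ M : ℝ, ∀ x, ‖(v i j x : ℂ)‖ ≤ M) (hC : 2 ≤ C.parts.card)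
    (K : UnitAddTorus (Fin d)) :
    spectrum ℂ (clusterOperator e v C K) = essentialSpectrum (clusterOperator e v C K) := by
  -- A cluster without the last particle moves relative to the origin, so its translation by a unit
  -- vector is nontrivial. The unit vector exists since d > 0, and the phase of this cluster is 1.
  obtain ⟨c, hc⟩ := exists_cluster_last_notMem C hC
  let s : Fin d → ℤ := Pi.single ⟨0, hd⟩ 1
  have hs : clusterHop c.1 s ≠ 0 := fun h => by
    have h1 := position_clusterHop c.1 s (leader c.1)
    rw [h, position_zero, if_pos (leader_mem c.1), if_neg hc, sub_zero, one_smul] at h1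
    have h2 := congrFun h1 ⟨0, hd⟩
    simp [s] at h2
  have hcomm : Commute (∑ c : {s : Finset (Fin N) // s ∈ C.parts}, clusterPart c.1 e v K)
      (shift (clusterHop c.1 s)) := by
    refine Commute.sum_left _ _ _ fun c' _ => ?_
    have h1 : shift (clusterHop c.1 s) = clusterShift c.1 K s := by
      rw [clusterShift, clusterPhase, if_neg hc, one_smul]
    rw [h1]
    refine (clusterShift_commute_clusterPart c'.1 hv ?_ K s).symm
    rcases eq_or_ne c' c with rfl | h
    · exact Or.inl rfl
    · exact Or.inr (disjoint_clusters C h)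
  let Ψ := fourierConj (Fin N) d
  have hcomm' : Commute (clusterOperator e v C K) (Ψ.symm (shift (clusterHop c.1 s))) := by
    have := hcomm.map Ψ.symm
    rwa [← fourierConj_clusterOperator C he v K, ContinuousAlgEquiv.symm_apply_apply] at this
  refine (Set.sep_eq_self_iff_mem_true.2 fun z _ => ?_).symm
  rintro ⟨-, hz, hfin⟩
  refine not_finiteDimensional_eigenspace hcomm' (fun F y hF => ?_) hz hfin
  let 𝓕 := fourierTransform (Others (Fin N) × Fin d)
  change 𝓕 (shift (clusterHop c.1 s) (𝓕.symm F)) = y • F at hF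
  have h1 : shift (clusterHop c.1 s) (𝓕.symm F) = y • 𝓕.symm F := by
    rw [← map_smul, ← hF, LinearIsometryEquiv.symm_apply_apply]
  have h2 := eq_zero_of_shift_eq_smul hs h1
  rwa [LinearIsometryEquiv.map_eq_zero_iff] at h2

end Essential

/-! ### Consequences of the regularity hypotheses. -/

theorem summable_of_summable_rpow_mul {d : ℕ} {e : (Fin d → ℤ) → ℂ} {δ : ℝ} (hδ : 0 < δ)
    (h : Summable fun y : Fin d → ℤ => (∑ a, |(y a : ℝ)|) ^ δ * ‖e y‖) :
    Summable fun y => ‖e y‖ := by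
  -- The weight is at least 1 except at y = 0, where it vanishes because δ > 0; this single point is
  -- discarded.
  refine Summable.of_norm_bounded_eventually h ?_
  refine (Set.finite_singleton (0 : Fin d → ℤ)).subset fun y hy => ?_
  by_contra hne
  refine hy ?_
  obtain ⟨a, ha⟩ := Function.ne_iff.1 (show y ≠ 0 from hne)
  have h1 : (1 : ℝ) ≤ |(y a : ℝ)| := by exact_mod_cast Int.one_le_abs ha
  have h2 : (1 : ℝ) ≤ ∑ a, |(y a : ℝ)| :=
    h1.trans (Finset.single_le_sum (f := fun a => |(y a : ℝ)|) (fun _ _ => abs_nonneg _)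
      (Finset.mem_univ a))
  change ‖‖e y‖‖ ≤ _
  rw [norm_norm]
  exact le_mul_of_one_le_left (norm_nonneg _) (Real.one_le_rpow h2 hδ.le)

theorem exists_bound_of_tendsto {X : Type} {w : X → ℝ} (h : Tendsto w cofinite (𝓝 0)) :
    ∃ M : ℝ, ∀ x, ‖(w x : ℂ)‖ ≤ M := by
  obtain ⟨M, hM⟩ := h.norm.bddAbove_range_of_cofinite
  exact ⟨M, fun x => by
    rw [Complex.norm_real]
    exact hM ⟨x, rfl⟩⟩

end LatticeSchrodinger

end

theorem theorem2p1 (d N : ℕ) [NeZero N] (hd : 0 < d)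
    (e : Fin N → (Fin d → ℤ) → ℂ) (v : Fin N → Fin N → (Fin d → ℤ) → ℝ)
    (he_reg : ∀ i, ∃ δ : ℝ, 0 < δ ∧
      Summable fun y : Fin d → ℤ => (∑ a, |(y a : ℝ)|) ^ δ * ‖e i y‖)
    (he_sa : ∀ i y, e i y = conj (e i (-y)))
    (hv : ∀ i j, i < j → Tendsto (v i j) cofinite (𝓝 0))
    (C : Finpartition (Finset.univ : Finset (Fin N))) (hC : 2 ≤ C.parts.card)
    (K : UnitAddTorus (Fin d)) :
    spectrum ℂ (LatticeSchrodinger.clusterOperator e v C K) =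
        LatticeSchrodinger.essentialSpectrum (LatticeSchrodinger.clusterOperator e v C K) ∧
      LatticeSchrodinger.essentialSpectrum (LatticeSchrodinger.clusterOperator e v C K) =
        ⋃ (k : {s : Finset (Fin N) // s ∈ C.parts} → UnitAddTorus (Fin d))
          (_ : ∑ c, k c = K),
          ∑ c, spectrum ℂ (LatticeSchrodinger.clusterHamiltonian e v C c (k c)) := by
  have he : ∀ i, Summable fun s => ‖e i s‖ := fun i => by
    obtain ⟨δ, hδ, h⟩ := he_reg i
    exact LatticeSchrodinger.summable_of_summable_rpow_mul hδ h
  have hv' : ∀ i j, i < j → ∃ M : ℝ, ∀ x, ‖(v i j x : ℂ)‖ ≤ M := fun i j hij =>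
    LatticeSchrodinger.exists_bound_of_tendsto (hv i j hij)
  have hess := LatticeSchrodinger.spectrum_clusterOperator_eq_essentialSpectrum C hd he hv' hC K
  refine ⟨hess, ?_⟩
  have hσ : ∀ (c : {s : Finset (Fin N) // s ∈ C.parts}) (k : UnitAddTorus (Fin d)),
      spectrum ℂ (LatticeSchrodinger.clusterHamiltonian e v C c k)
        = spectrum ℂ (LatticeSchrodinger.latticeHamiltonian (ι := {i : Fin N // i ∈ c.1})
          (fun i => e i) (fun i j => v i j) k) := fun c k =>
    LatticeSchrodinger.spectrum_fiberHamiltonian (ι := {i : Fin N // i ∈ c.1}) (e := fun i => e i)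
      (fun i => he i) (fun i j => v i j) k
  rw [← hess, ← AlgEquiv.spectrum_eq (LatticeSchrodinger.fourierConj (Fin N) d),
    LatticeSchrodinger.fourierConj_clusterOperator C he v K]
  ext z
  simp only [Set.mem_iUnion, Set.mem_fintype_sum, hσ]
  constructor
  · intro hz
    obtain ⟨k, w, hk, hw, hkw⟩ :=
      LatticeSchrodinger.mem_sum_spectrum_of_mem_spectrum C he he_sa hv' K hz
    exact ⟨k, hk, w, hkw, hw⟩
  · rintro ⟨k, hk, w, hkw, rfl⟩
    exact LatticeSchrodinger.sum_mem_spectrum C he he_sa hv' hk hkw
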